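/- **Setting.** Let $K$ be a field of characteristic $0$, $G$ an abelian group and $L=\bigoplus_{g\in G}L_g$ a $G$-graded Lie algebra over $K$, $[L_g,L_h]\subset L_{g+h}$. Let $C^q_{(g)}(L;L)$ be the space of skew-symmetric $q$-linear maps $\varphi\colon L^q\to L$ with $\varphi(l_1,\dots,l_q)\in L_{g_1+\dots+g_q-g}$ for $l_i\in L_{g_i}$, put $C^q(L;L)=\bigoplus_g C^q_{(g)}(L;L)$ with the Chevalley–Eilenberg differential $$(\delta\gamma)(l_1,\dots,l_{q+1})=\sum_{s<t}(-1)^{s+t-1}\gamma([l_s,l_t],l_1,\dots\hat l_s\dots\hat l_t\dots,l_{q+1})+\sum_u(-1)^u[l_u,\gamma(l_1,\dots\hat l_u\dots,l_{q+1})],$$ and let $H^q(L;L)=\bigoplus_g H^q_{(g)}(L;L)$ be its cohomology. Assume $\dim H^2_{(g)}(L;L)<\infty$ for every $g$. Fix a basis $(b_i)_{i\in\iota}$ of $H^2(L;L)$ with $b_i\in H^2_{(g_i)}(L;L)$. Let $R=K[[x_i : i\in\iota]]$ be the ring of all formal power series in the dual coordinates (the full dual of the coalgebra $S^*(H^2(L;L))$;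 infinite sums of monomials of the same polynomial degree are allowed), with $x_i$ of $G$-degree $g_i$, and let $\mathfrak m\subset R$ be the ideal of series without constant term. For an ideal $J\subset R$ let $(R/J)'$ be the space of those $s\in S^*(H^2(L;L))$, that is, of those finite linear combinations of coefficient functionals on $R$, that vanish on $J$. **Construction of the base of the miniversal deformation.** A skew-symmetric bracket $\{l,l'\}=\sum_d x^d\alpha_d(l,l')$ with coefficients in $R$ and a sequence of ideals $I_1,I_2,\dots$ of $R$ are given such that: * $\alpha_d\in C^2_{(g)}(L;L)$, where $g$ is the degree of $x^d$; $\alpha_0$ is the bracket of $L$; the coefficient of $x_i$ is a cocycle representing $b_i$; * $I_1$ is the ideal of series without constant and linear terms; * for each $k\ge1$ the bracket satisfies the Jacobi identity modulo $I_k$, that is, every $s\in(R/I_k)'$ annihilates the jacobiator $\{\{l_1,l_2\},l_3\}+\{\{l_2,l_3\},l_1\}+\{\{l_3,l_1\},l_2\}$ (so that a deformation of $L$ with base $C_k=R/I_k$ is given); * $I_{k+1}$ is the annihilator in $R$ of the set of those $s\in(R/\mathfrak m I_k)'$ for which the value on $s$ of the jacobiator is a coboundary $\delta c$, $c\in C^2(L;L)$,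 i.e. for which the obstruction class in $H^3(L;L)$ vanishes. Put $I=\bigcap_k I_k$; the base of the resulting miniversal deformation is given by $R/I$. **Proposition 7.3.** For every such construction the following holds. 1. The ideal $I$ is generated by homogeneous elements, with at most $\dim H^3_{(g)}(L;L)$ generators of degree $g$ for each $g\in G$. Precisely, there are sets $T_g\subset R$, $g\in G$, of homogeneous elements of degree $g$, with $|T_g|\le\dim H^3_{(g)}(L;L)$ (as cardinals), such that, with $T=\bigcup_gT_g$, every monomial occurs in only finitely many elements of $T$ and $I$ is exactly the set of all (possibly infinite, coefficientwise finite) sums $\sum_{t\in T}a_tt$, $a_t\in R$. If $\dim H^2(L;L)<\infty$, then $I$ is the ideal generated by $T$ in the ordinary algebraic sense. 2. The base is the zero locus of a formal map $F\colon H^2(L;L)\to H^3(L;L)$ of degree $0$: there is a formal power series $F=\sum_dx^dF_d$ with $F_d\in H^3_{(g)}(L;L)$, $g$ being the degree of $x^d$, such that $I$ is the closed ideal generated by the components $\phi\circ F$, where $\phi$ runs over the linear functionals on $H^3(L;L)$ (that is, an element of $R$ lies in $I$ if and only if it agrees on each finite set of monomials with an element of the ideal generated by these components). If $\dim H^2(L;L)<\infty$,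 then $I$ is the ideal generated by these components. -/

import Mathlib

universe uK uL uG uι

noncomputable section

namespace GradedLie

section Cohomology

variable {K L G : Type*} [Field K] [LieRing L] [LieAlgebra K L] [AddCommGroup G]

/-- The space of all skew-symmetric `q`-linear maps `L × ... × L → L`, i.e. `Hom(Λ^q L, L)`. -/
abbrev Cochain (K L : Type*) [Field K] [LieRing L] [LieAlgebra K L] (q : ℕ) :=
  L [⋀^Fin q]→ₗ[K] L

/-- The Chevalley-Eilenberg differential with adjoint coefficients on `(n+1)`-cochains:
`(δγ)(l_1,...,l_{q+1}) = ∑_{s<t} (-1)^{s+t-1} γ([l_s,l_t], l_1,..,^l_s,..,^l_t,..,l_{q+1})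
  + ∑_u (-1)^u [l_u, γ(l_1,..,^l_u,..,l_{q+1})]`, where `q = n+1`.
The 0-based positions of the two removed entries in the first sum are `s ≤ n` and `t+1` with
`s ≤ t`, so the sign `(-1)^{s+t-1}` of the 1-based formula becomes `(-1)^(s+t)`. The value is
recorded as a plain function of the arguments. -/
def delta (n : ℕ) : Cochain K L (n + 1) →ₗ[K] ((Fin (n + 2) → L) → L) where
  toFun γ v :=
    (∑ t : Fin (n + 1), ∑ s ∈ Finset.Iic t,
      (-1 : ℤ) ^ ((s : ℕ) + (t : ℕ)) •
        γ (Fin.cons ⁅v s.castSucc, v t.succ⁆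
          (fun i : Fin n => v (t.succ.succAbove (s.succAbove i))))) +
    ∑ u : Fin (n + 2), (-1 : ℤ) ^ ((u : ℕ) + 1) • ⁅v u, γ (fun i => v (u.succAbove i))⁆
  map_add' γ γ' := by
    funext v
    simp only [AlternatingMap.add_apply, smul_add, lie_add, Finset.sum_add_distrib, Pi.add_apply]
    exact add_add_add_comm _ _ _ _
  map_smul' a γ := by
    funext v
    simp only [AlternatingMap.smul_apply, lie_smul, RingHom.id_apply, Pi.smul_apply, smul_add,
      Finset.smul_sum, smul_comm a]

/-- The homogeneous cochains `C^q_{(g)}(L;L)`: those `φ` with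
`φ(l_1,...,l_q) ∈ L_{g_1+...+g_q-g}` whenever `l_i ∈ L_{g_i}`. -/
def homCochain (𝒜 : G → Submodule K L) (q : ℕ) (g : G) : Submodule K (Cochain K L q) where
  carrier := {φ | ∀ (e : Fin q → G) (v : Fin q → L), (∀ i, v i ∈ 𝒜 (e i)) →
    φ v ∈ 𝒜 ((∑ i, e i) - g)}
  add_mem' hφ hψ e v hv := Submodule.add_mem _ (hφ e v hv) (hψ e v hv)
  zero_mem' _ _ _ := Submodule.zero_mem _
  smul_mem' a _ hφ e v hv := Submodule.smul_mem _ a (hφ e v hv)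

/-- The cochain space of the graded Lie algebra, `C^q(L;L) = ⨁_g C^q_{(g)}(L;L)`. -/
def gradedCochain (𝒜 : G → Submodule K L) (q : ℕ) : Submodule K (Cochain K L q) :=
  ⨆ g, homCochain 𝒜 q g

/-- The cocycles in `C^{n+1}(L;L)`. -/
def cocycle (𝒜 : G → Submodule K L) (n : ℕ) : Submodule K (Cochain K L (n + 1)) :=
  gradedCochain 𝒜 (n + 1) ⊓ LinearMap.ker (delta n)

/-- The coboundaries in `C^{n+2}(L;L)`: the cochains `φ = δγ` with `γ ∈ C^{n+1}(L;L)`. -/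
def coboundary (𝒜 : G → Submodule K L) (n : ℕ) : Submodule K (Cochain K L (n + 2)) where
  carrier := {φ | ∃ γ ∈ gradedCochain 𝒜 (n + 1), delta n γ = fun v => φ v}
  add_mem' := by
    rintro φ ψ ⟨γ, hγ, h⟩ ⟨γ', hγ', h'⟩
    exact ⟨γ + γ', Submodule.add_mem _ hγ hγ', by rw [map_add, h, h']; rfl⟩
  zero_mem' := ⟨0, Submodule.zero_mem _, by rw [map_zero]; rfl⟩
  smul_mem' := by
    rintro a φ ⟨γ, hγ, h⟩
    exact ⟨a • γ, Submodule.smul_mem _ a hγ, by rw [map_smul, h]; rfl⟩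

/-- The cohomology `H^{n+2}(L;L)`, cocycles modulo coboundaries. -/
abbrev Coh (𝒜 : G → Submodule K L) (n : ℕ) : Type _ :=
  cocycle 𝒜 (n + 1) ⧸ (coboundary 𝒜 n).submoduleOf (cocycle 𝒜 (n + 1))

/-- `H^2(L;L)`. -/
abbrev H2 (𝒜 : G → Submodule K L) : Type _ := Coh 𝒜 0

/-- `H^3(L;L)`. -/
abbrev H3 (𝒜 : G → Submodule K L) : Type _ := Coh 𝒜 1

/-- The graded piece `H^{n+2}_{(g)}(L;L)`: the classes of the cocycles in `C^{n+2}_{(g)}(L;L)`. -/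
def cohPiece (𝒜 : G → Submodule K L) (n : ℕ) (g : G) : Submodule K (Coh 𝒜 n) :=
  ((homCochain 𝒜 (n + 2) g).submoduleOf (cocycle 𝒜 (n + 1))).map
    ((coboundary 𝒜 n).submoduleOf (cocycle 𝒜 (n + 1))).mkQ

/-- The graded piece `H^2_{(g)}(L;L)`. -/
abbrev H2piece (𝒜 : G → Submodule K L) (g : G) : Submodule K (H2 𝒜) := cohPiece 𝒜 0 g

/-- The graded piece `H^3_{(g)}(L;L)`. -/
abbrev H3piece (𝒜 : G → Submodule K L) (g : G) : Submodule K (H3 𝒜) := cohPiece 𝒜 1 g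

end Cohomology

section Construction

variable {K L G ι : Type*} [Field K] [LieRing L] [LieAlgebra K L] [AddCommGroup G]

/-- Formal power series on `H^2(L;L)`. A basis of `H^2(L;L)` indexed by `ι` is fixed, `x_i` is the
dual coordinate, and `K[[H']]` is the ring of formal power series in the `x_i`. It is the full dual
of the coalgebra `S^*(H^2(L;L))`, whose elements are the finite combinations `∑ s_d e_d`,
`e_d` being dual to the monomial `x^d`, and are encoded by the finitely supported families `s`.
For a formal series `c = ∑ x^d c_d` with coefficients in a vector space `V`, this is the value
`∑ s_d c_d` of `c` on `s`. -/
def pair {V : Type*} [AddCommGroup V] [Module K V] (c : (ι →₀ ℕ) → V) (s : (ι →₀ ℕ) →₀ K) : V :=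
  s.sum fun d a => a • c d

/-- The value `∑ s_d f_d` of the formal power series `f` on `s`. -/
def evalAt (f : MvPowerSeries ι K) (s : (ι →₀ ℕ) →₀ K) : K :=
  pair (fun d => MvPowerSeries.coeff d f) s

/-- `(K[[H']]/I)'`: the subspace of the `s ∈ S^*(H^2(L;L))` annihilated by the ideal `I`. -/
def dualOf (I : Ideal (MvPowerSeries ι K)) : Set ((ι →₀ ℕ) →₀ K) :=
  {s | ∀ f ∈ I, evalAt f s = 0}

/-- The ideal `𝔪` of the formal power series without constant term. -/
def maxIdeal (K ι : Type*) [Field K] : Ideal (MvPowerSeries ι K) :=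
  RingHom.ker (MvPowerSeries.constantCoeff (σ := ι) (R := K))

open scoped Classical in
/-- For the skew-symmetric bracket `{l, l'} = ∑ x^d α_d(l, l')` with power series coefficients,
extended bilinearly over power series, the coefficient at `x^d` of
`{{l_1,l_2},l_3} + {{l_2,l_3},l_1} + {{l_3,l_1},l_2}`. -/
def jacobiator (α : (ι →₀ ℕ) → Cochain K L 2) (d : ι →₀ ℕ) (v : Fin 3 → L) : L :=
  ∑ p ∈ Finset.HasAntidiagonal.antidiagonal d,
    (α p.1 ![α p.2 ![v 0, v 1], v 2] + α p.1 ![α p.2 ![v 1, v 2], v 0]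
      + α p.1 ![α p.2 ![v 2, v 0], v 1])

/-- The value of the jacobiator on `s`, as a function of `l_1, l_2, l_3`. -/
def jacobiatorAt (α : (ι →₀ ℕ) → Cochain K L 2) (s : (ι →₀ ℕ) →₀ K) : (Fin 3 → L) → L :=
  pair (jacobiator α) s

/-- The `G`-degree of the monomial `x^d`, where `x_i` has degree `deg i`. -/
def monDeg (deg : ι → G) (d : ι →₀ ℕ) : G := d.sum fun i n => n • deg i

/-- The (graded) inductive construction of the base of the miniversal deformation of `L`.

The base is built step by step: `I k` is the ideal `I_{k+1}` of `R = K[[H']]` and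
`C_{k+1} = R / I_{k+1}`. The deformation `η_{k+1}` of `L` with base `C_{k+1}` is the reduction
modulo `I_{k+1}` of one skew-symmetric bracket `{l, l'} = ∑ x^d α_d(l, l')` with coefficients in
`R`; the coefficients of this bracket outside of the spaces `C_{k+1}'` play no role.

* `degree_zero`: the bracket has degree `0` with respect to the grading by `G`;
* `reduction`: modulo `𝔪`, it is the bracket of `L`;
* `infinitesimal`: its linear part takes each basis element of `H^2(L;L)` to a cocycle
  representing it, that is, `η_1` is the universal infinitesimal deformation;
* `first`: `I_1` is the ideal `𝔪²` of the series with no constant and no linear terms;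
* `jacobi`: modulo `I_{k+1}`, the bracket satisfies the Jacobi identity;
* `next`: the universal extension of `C_{k+1}` is `R / (𝔪 I_{k+1})`; the bracket lifts the one of
  `η_{k+1}` to it, and the cohomology class in `H^3(L;L)` of the value of its jacobiator on
  `s ∈ (R / (𝔪 I_{k+1}))'` is the obstruction `ω(s)` to extending `η_{k+1}`. The ideal `I_{k+2}`
  is the annihilator of `Ker ω`, so that `C_{k+2}` is the quotient of `R / (𝔪 I_{k+1})` by the
  image of the dual of `ω`. -/
structure IsMiniversalConstruction (𝒜 : G → Submodule K L) (b : Module.Basis ι K (H2 𝒜))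
    (deg : ι → G) (α : (ι →₀ ℕ) → Cochain K L 2) (I : ℕ → Ideal (MvPowerSeries ι K)) : Prop where
  degree_zero : ∀ d, α d ∈ homCochain 𝒜 2 (monDeg deg d)
  reduction : ∀ l l' : L, α 0 ![l, l'] = ⁅l, l'⁆
  infinitesimal : ∀ i, ∃ z : cocycle 𝒜 1, (z : Cochain K L 2) = α (Finsupp.single i 1) ∧
    Submodule.Quotient.mk z = b i
  first : ∀ f, f ∈ I 0 ↔ ∀ d : ι →₀ ℕ, d.degree ≤ 1 → MvPowerSeries.coeff d f = 0
  jacobi : ∀ k, ∀ s ∈ dualOf (I k), jacobiatorAt α s = 0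
  next : ∀ k f, f ∈ I (k + 1) ↔ ∀ s ∈ dualOf (maxIdeal K ι * I k),
    (∃ c ∈ gradedCochain 𝒜 2, delta 1 c = jacobiatorAt α s) → evalAt f s = 0

end Construction

section Conclusion

variable {K G ι : Type*} [Field K] [AddCommGroup G]

/-- The formal power series `f` is homogeneous of degree `g`, where `x_i` has degree `deg i`. -/
def IsHomogeneousOfDegree (deg : ι → G) (f : MvPowerSeries ι K) (g : G) : Prop :=
  ∀ d, MvPowerSeries.coeff d f ≠ 0 → monDeg deg d = g

/-- Every monomial occurs in only finitely many elements of `T`, and the ideal `I` consists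
precisely of the (possibly infinite) sums `∑_{t ∈ T} a_t t` with power series coefficients `a_t`.
The first condition makes every such sum coefficientwise finite. For a finite set `T` this says
that `I` is the ideal generated by `T`. -/
def FormallyGenerates (T : Set (MvPowerSeries ι K)) (I : Ideal (MvPowerSeries ι K)) : Prop :=
  (∀ d, {t ∈ T | MvPowerSeries.coeff d t ≠ 0}.Finite) ∧
  ∀ f, f ∈ I ↔ ∃ a : MvPowerSeries ι K → MvPowerSeries ι K,
    ∀ d, MvPowerSeries.coeff d f = ∑ᶠ t ∈ T, MvPowerSeries.coeff d (a t * t)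

/-- The components `φ ∘ F`, `φ ∈ V'`, of a formal map `F = ∑ x^d F_d` to a vector space `V`. -/
def components {V : Type*} [AddCommGroup V] [Module K V] (F : (ι →₀ ℕ) → V) :
    Set (MvPowerSeries ι K) :=
  {f | ∃ φ : Module.Dual K V, ∀ d, MvPowerSeries.coeff d f = φ (F d)}

/-- `I` is the closed ideal generated by `T`: it consists of the power series which agree, on any
given finite set of monomials, with an element of the ideal generated by `T`. -/
def TopologicallyGenerates (T : Set (MvPowerSeries ι K)) (I : Ideal (MvPowerSeries ι K)) : Prop :=
  ∀ f, f ∈ I ↔ ∀ D : Finset (ι →₀ ℕ), ∃ h ∈ Ideal.span T,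
    ∀ d ∈ D, MvPowerSeries.coeff d f = MvPowerSeries.coeff d h

end Conclusion

end GradedLie

end

open GradedLie

noncomputable section

/-! The ring R is the full linear dual of S^*(H^2), so a closed ideal J is the same thing as its
annihilator (R/J)', a subspace of S^* stable under contraction with monomials. In this dual picture
(R/𝔪J)' consists of the s all of whose contractions with nontrivial monomials lie in (R/J)'
(`mem_dualSub_maxIdeal_mul`).

Let I be the intersection of the ideals. For s in (R/𝔪I)' the jacobiator vanishes on all proper
contractions of s, so the Bianchi identity (`sum_twistedDelta_jacMap`) reduces to δ(jacobiator(s)) =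
0. This gives a degree-0 obstruction map ω from (R/𝔪I)' to H^3. Its kernel is exactly (R/I)'
(`obstruction_eq_zero_iff`): s has finitely many nonzero contractions, so it already lies in
(R/𝔪I_k)' for some k, and a coboundary value puts it in (R/I_{k+1})'. Thus (R/𝔪I)'/(R/I)' embeds in
H^3 degree by degree, a dual form of Nakayama's bound on the number of generators.

To produce generators, ω is extended to a degree-0 map on S^*, that is, to a series F with
coefficients in H^3. Induction on polynomial degree shows that (R/I)' is the set of s whose
contractions are all killed by F (`mem_dualSub_iff_forall_contract`). The coordinates of F in
homogeneous bases then form a locally finite generating set, because a linear form vanishing on the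
kernel of a linear map factors through that map (`formallyGenerates_of_mem_dualSub_iff`). -/

namespace GradedLie

/-! ### Duality between power series and S^*, contraction, grading. -/

section Duality

variable {K G ι : Type*} [Field K] [AddCommGroup G]

/-- Evaluation of a power series, as a linear form on `S^*`. -/
def evalLin (f : MvPowerSeries ι K) : ((ι →₀ ℕ) →₀ K) →ₗ[K] K :=
  Finsupp.linearCombination K fun d => MvPowerSeries.coeff d f

lemma evalLin_apply (f : MvPowerSeries ι K) (s : (ι →₀ ℕ) →₀ K) : evalLin f s = evalAt f s := rfl

lemma evalAt_single (f : MvPowerSeries ι K) (d : ι →₀ ℕ) (a : K) :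
    evalAt f (Finsupp.single d a) = a * MvPowerSeries.coeff d f := by
  rw [← evalLin_apply, evalLin, Finsupp.linearCombination_single, smul_eq_mul]

lemma evalAt_eq_sum (f : MvPowerSeries ι K) (s : (ι →₀ ℕ) →₀ K) :
    evalAt f s = ∑ d ∈ s.support, s d * MvPowerSeries.coeff d f := rfl

lemma evalAt_congr {f h : MvPowerSeries ι K} {s : (ι →₀ ℕ) →₀ K}
    (H : ∀ d ∈ s.support, MvPowerSeries.coeff d f = MvPowerSeries.coeff d h) :
    evalAt f s = evalAt h s := by
  rw [evalAt_eq_sum, evalAt_eq_sum]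
  exact Finset.sum_congr rfl fun d hd => by rw [H d hd]

lemma evalAt_add (f h : MvPowerSeries ι K) (s : (ι →₀ ℕ) →₀ K) :
    evalAt (f + h) s = evalAt f s + evalAt h s := by
  simp only [evalAt_eq_sum, map_add, mul_add, Finset.sum_add_distrib]

/-- The power series with the given coefficients. -/
def ofCoeff (c : (ι →₀ ℕ) → K) : MvPowerSeries ι K := c

@[simp]
lemma coeff_ofCoeff (c : (ι →₀ ℕ) → K) (d : ι →₀ ℕ) : MvPowerSeries.coeff d (ofCoeff c) = c d := rfl

/-- Every linear form on `S^*` is the evaluation of a power series. -/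
lemma exists_evalLin_eq (φ : ((ι →₀ ℕ) →₀ K) →ₗ[K] K) :
    ∃ f : MvPowerSeries ι K, evalLin f = φ := by
  refine ⟨ofCoeff fun d => φ (Finsupp.single d 1), ?_⟩
  ext d
  simp only [LinearMap.comp_apply, Finsupp.lsingle_apply]
  rw [evalLin_apply, evalAt_single, one_mul, coeff_ofCoeff]

/-- The submodule underlying `dualOf I`. -/
def dualSub (I : Ideal (MvPowerSeries ι K)) : Submodule K ((ι →₀ ℕ) →₀ K) where
  carrier := dualOf I
  add_mem' hs ht f hf := by
    rw [← evalLin_apply, map_add, evalLin_apply, evalLin_apply, hs f hf, ht f hf, add_zero]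
  zero_mem' f _ := by rw [← evalLin_apply, map_zero]
  smul_mem' a s hs f hf := by
    rw [← evalLin_apply, map_smul, evalLin_apply, hs f hf, smul_zero]

lemma dualSub_anti {I J : Ideal (MvPowerSeries ι K)} (h : I ≤ J) : dualSub J ≤ dualSub I :=
  fun _ hs f hf => hs f (h hf)

/-- A subspace of `S^*` is the annihilator of its annihilator. -/
lemma dualSub_eq_of_mem_iff {I : Ideal (MvPowerSeries ι K)} {A : Submodule K ((ι →₀ ℕ) →₀ K)}
    (h : ∀ f, f ∈ I ↔ ∀ s ∈ A, evalAt f s = 0) : dualSub I = A := by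
  apply le_antisymm
  · intro s hs
    by_contra hsA
    -- A linear form separating `s` from `A` is itself a power series, and that series lies in `I`.
    obtain ⟨φ, hφ, hA⟩ := Submodule.exists_le_ker_of_notMem hsA
    obtain ⟨f, rfl⟩ := exists_evalLin_eq φ
    exact hφ (hs f ((h f).2 fun t ht => hA ht))
  · exact fun s hs f hf => (h f).1 hf s hs

/-- Contraction of `S^*` with the monomial `x^p`. -/
def contract (p : ι →₀ ℕ) : ((ι →₀ ℕ) →₀ K) →ₗ[K] ((ι →₀ ℕ) →₀ K) :=
  Finsupp.lcomapDomain (fun q => q + p) (add_left_injective p)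

lemma contract_apply (p q : ι →₀ ℕ) (s : (ι →₀ ℕ) →₀ K) : contract p s q = s (q + p) := rfl

lemma contract_contract (p q : ι →₀ ℕ) (s : (ι →₀ ℕ) →₀ K) :
    contract p (contract q s) = contract (p + q) s := by
  ext r
  simp only [contract_apply, add_assoc]

lemma contract_zero (s : (ι →₀ ℕ) →₀ K) : contract 0 s = s := by
  ext r
  simp only [contract_apply, add_zero]

lemma contract_single_add (p q : ι →₀ ℕ) (a : K) :
    contract p (Finsupp.single (q + p) a) = Finsupp.single q a := by
  classical
  ext r
  simp [contract_apply, Finsupp.single_apply]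

lemma contract_single_of_not_le {p d : ι →₀ ℕ} (h : ¬ p ≤ d) (a : K) :
    contract p (Finsupp.single d a) = 0 := by
  classical
  ext r
  rw [contract_apply, Finsupp.single_apply, if_neg, Finsupp.zero_apply]
  rintro rfl
  exact h le_add_self

open scoped Classical in
/-- The exponents dividing some exponent in the support of `s`. -/
def divisors (s : (ι →₀ ℕ) →₀ K) : Finset (ι →₀ ℕ) :=
  s.support.biUnion fun d => (Finset.HasAntidiagonal.antidiagonal d).image Prod.fst

lemma mem_divisors {s : (ι →₀ ℕ) →₀ K} {p : ι →₀ ℕ} :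
    p ∈ divisors s ↔ ∃ d ∈ s.support, p ≤ d := by
  classical
  simp only [divisors, Finset.mem_biUnion, Finset.mem_image, Finset.HasAntidiagonal.mem_antidiagonal, Prod.exists,
    exists_and_right, exists_eq_right]
  refine exists_congr fun d => and_congr_right fun _ => ?_
  rw [le_iff_exists_add]
  exact exists_congr fun _ => eq_comm

lemma contract_eq_zero {s : (ι →₀ ℕ) →₀ K} {p : ι →₀ ℕ} (h : p ∉ divisors s) :
    contract p s = 0 := by
  ext q
  by_contra hne
  exact h (mem_divisors.2 ⟨q + p, Finsupp.mem_support_iff.2 hne, le_add_self⟩)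

open scoped Classical in
/-- A convolution of coefficients takes on `s` the sum of the values on the contractions of `s`. -/
lemma linearCombination_antidiagonal {V : Type*} [AddCommGroup V] [Module K V]
    (Ψ : (ι →₀ ℕ) → (ι →₀ ℕ) → V) (s : (ι →₀ ℕ) →₀ K) :
    Finsupp.linearCombination K (fun d => ∑ x ∈ Finset.HasAntidiagonal.antidiagonal d, Ψ x.1 x.2) s =
      ∑ p ∈ divisors s, Finsupp.linearCombination K (Ψ p) (contract p s) := by
  -- An oversized index set `P`, common to all `d`, makes both sides additive in `s` and reduces the
  -- claim to single monomials.
  have key : ∀ (P : Finset (ι →₀ ℕ)) (d : ι →₀ ℕ) (a : K), (∀ p ≤ d, p ∈ P) →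
      Finsupp.linearCombination K (fun d => ∑ x ∈ Finset.HasAntidiagonal.antidiagonal d, Ψ x.1 x.2)
        (Finsupp.single d a) =
      ∑ p ∈ P, Finsupp.linearCombination K (Ψ p) (contract p (Finsupp.single d a)) := by
    intro P d a hP
    rw [Finsupp.linearCombination_single, Finset.smul_sum]
    have h1 : ∑ p ∈ P, Finsupp.linearCombination K (Ψ p) (contract p (Finsupp.single d a)) =
        ∑ p ∈ (Finset.HasAntidiagonal.antidiagonal d).image Prod.fst,
          Finsupp.linearCombination K (Ψ p) (contract p (Finsupp.single d a)) := by
      symm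
      apply Finset.sum_subset
      · intro p hp
        obtain ⟨x, hx, rfl⟩ := Finset.mem_image.1 hp
        rw [Finset.HasAntidiagonal.mem_antidiagonal] at hx
        exact hP _ (hx ▸ le_self_add)
      · intro p _ hp
        rw [contract_single_of_not_le, map_zero]
        intro hle
        obtain ⟨q, rfl⟩ := exists_add_of_le hle
        exact hp (Finset.mem_image.2 ⟨(p, q), by simp, rfl⟩)
    rw [h1, Finset.sum_image]
    · refine Finset.sum_congr rfl fun x hx => ?_
      rw [Finset.HasAntidiagonal.mem_antidiagonal] at hx
      rw [← hx, add_comm, contract_single_add, Finsupp.linearCombination_single]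
    · rintro ⟨p, q⟩ hx ⟨p', q'⟩ hy h
      simp only [Finset.mem_coe, Finset.HasAntidiagonal.mem_antidiagonal] at hx hy h
      subst h
      rw [← hy] at hx
      rw [add_left_cancel hx]
  have hs : s = ∑ d ∈ s.support, Finsupp.single d (s d) := (Finsupp.sum_single s).symm
  have : ∀ P : Finset (ι →₀ ℕ), (∀ d ∈ s.support, ∀ p ≤ d, p ∈ P) →
      Finsupp.linearCombination K (fun d => ∑ x ∈ Finset.HasAntidiagonal.antidiagonal d, Ψ x.1 x.2) s =
      ∑ p ∈ P, Finsupp.linearCombination K (Ψ p) (contract p s) := by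
    intro P hP
    conv_lhs => rw [hs]
    conv_rhs =>
      enter [2, p]
      rw [hs]
    simp only [map_sum]
    rw [Finset.sum_comm]
    exact Finset.sum_congr rfl fun d hd => key P d _ (hP d hd)
  exact this _ fun d hd p hp => mem_divisors.2 ⟨d, hd, hp⟩

lemma evalAt_mul (a f : MvPowerSeries ι K) (s : (ι →₀ ℕ) →₀ K) :
    evalAt (a * f) s =
      ∑ p ∈ divisors s, MvPowerSeries.coeff p a * evalAt f (contract p s) := by
  classical
  have h := linearCombination_antidiagonal
    (fun p q => MvPowerSeries.coeff p a * MvPowerSeries.coeff q f) s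
  have h1 : evalAt (a * f) s = Finsupp.linearCombination K (fun d => ∑ x ∈ Finset.HasAntidiagonal.antidiagonal d,
      MvPowerSeries.coeff x.1 a * MvPowerSeries.coeff x.2 f) s := by
    simp only [← MvPowerSeries.coeff_mul]
    rfl
  rw [h1]
  convert h using 2 with p
  rw [evalAt_eq_sum, Finsupp.linearCombination_apply, Finsupp.sum, Finset.mul_sum]
  exact Finset.sum_congr rfl fun d _ => by rw [smul_eq_mul]; ring

/-- Contraction is adjoint to multiplication by a monomial; hence annihilators of ideals are stable
under it. -/
lemma evalAt_monomial_mul (p : ι →₀ ℕ) (f : MvPowerSeries ι K) (s : (ι →₀ ℕ) →₀ K) :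
    evalAt (MvPowerSeries.monomial p 1 * f) s = evalAt f (contract p s) := by
  classical
  rw [evalAt_mul, Finset.sum_eq_single p]
  · rw [MvPowerSeries.coeff_monomial_same, one_mul]
  · intro q _ hq
    rw [MvPowerSeries.coeff_monomial_ne hq, zero_mul]
  · intro hp
    rw [contract_eq_zero hp, ← evalLin_apply, map_zero, mul_zero]

lemma contract_mem_dualSub {J : Ideal (MvPowerSeries ι K)} {s : (ι →₀ ℕ) →₀ K}
    (hs : s ∈ dualSub J) (p : ι →₀ ℕ) : contract p s ∈ dualSub J := fun f hf => by
  rw [← evalAt_monomial_mul]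
  exact hs _ (J.mul_mem_left _ hf)

/-- A nontrivial monomial lies in 𝔪, which gives one direction. For the other, the value of `a * f`
on `s` is a sum over contractions in which `p = 0` carries the constant term of `a`, which is zero.
-/
lemma mem_dualSub_maxIdeal_mul {J : Ideal (MvPowerSeries ι K)} {s : (ι →₀ ℕ) →₀ K} :
    s ∈ dualSub (maxIdeal K ι * J) ↔ ∀ p ≠ 0, contract p s ∈ dualSub J := by
  classical
  constructor
  · intro hs p hp f hf
    rw [← evalAt_monomial_mul]
    refine hs _ (Ideal.mul_mem_mul ?_ hf)
    rw [maxIdeal, RingHom.mem_ker, ← MvPowerSeries.coeff_zero_eq_constantCoeff_apply,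
      MvPowerSeries.coeff_monomial_ne hp.symm]
  · intro hs f hf
    induction hf using Submodule.mul_induction_on' with
    | mem_mul_mem a ha f hf =>
      rw [evalAt_mul]
      refine Finset.sum_eq_zero fun p _ => ?_
      by_cases hp : p = 0
      · subst hp
        rw [maxIdeal, RingHom.mem_ker, ← MvPowerSeries.coeff_zero_eq_constantCoeff_apply] at ha
        rw [ha, zero_mul]
      · rw [hs p hp f hf, mul_zero]
    | add f _ h _ hf hh => rw [evalAt_add, hf, hh, add_zero]

lemma dualSub_le_maxIdeal_mul (J : Ideal (MvPowerSeries ι K)) :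
    dualSub J ≤ dualSub (maxIdeal K ι * J) := dualSub_anti Ideal.mul_le_right

section Degree

variable (deg : ι → G)

lemma monDeg_add (p q : ι →₀ ℕ) : monDeg deg (p + q) = monDeg deg p + monDeg deg q :=
  Finsupp.sum_add_index' (fun _ => zero_nsmul _) fun _ _ _ => add_nsmul _ _ _

open scoped Classical in
/-- The projection of `S^*` to its component of degree `g`. -/
def degProj (g : G) : ((ι →₀ ℕ) →₀ K) →ₗ[K] ((ι →₀ ℕ) →₀ K) where
  toFun s := s.filter fun d => monDeg deg d = g
  map_add' _ _ := Finsupp.filter_add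
  map_smul' _ _ := Finsupp.filter_smul

open scoped Classical in
lemma degProj_apply (g : G) (s : (ι →₀ ℕ) →₀ K) (d : ι →₀ ℕ) :
    degProj deg g s d = if monDeg deg d = g then s d else 0 := Finsupp.filter_apply _ _ _

lemma degProj_single_of_eq {g : G} {d : ι →₀ ℕ} (h : monDeg deg d = g) (a : K) :
    degProj deg g (Finsupp.single d a) = Finsupp.single d a := by
  classical
  exact Finsupp.filter_single_of_pos _ h

lemma degProj_single_of_ne {g : G} {d : ι →₀ ℕ} (h : monDeg deg d ≠ g) (a : K) :
    degProj deg g (Finsupp.single d a) = 0 := by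
  classical
  exact Finsupp.filter_single_of_neg _ h

lemma degProj_idem (g : G) (s : (ι →₀ ℕ) →₀ K) :
    degProj deg g (degProj deg g s) = degProj deg g s := by
  ext d
  simp only [degProj_apply]
  split_ifs <;> rfl

lemma contract_degProj (g : G) (p : ι →₀ ℕ) (s : (ι →₀ ℕ) →₀ K) :
    contract p (degProj deg g s) = degProj deg (g - monDeg deg p) (contract p s) := by
  ext d
  rw [contract_apply, degProj_apply, degProj_apply, contract_apply, monDeg_add]
  by_cases h : monDeg deg d + monDeg deg p = g
  · rw [if_pos h, if_pos (eq_sub_iff_add_eq.2 h)]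
  · rw [if_neg h, if_neg (mt eq_sub_iff_add_eq.1 h)]

open scoped Classical in
/-- The degrees of the monomials in the support of `s`. -/
def degrees (s : (ι →₀ ℕ) →₀ K) : Finset G := s.support.image (monDeg deg)

lemma degProj_eq_zero {g : G} {s : (ι →₀ ℕ) →₀ K} (h : g ∉ degrees deg s) :
    degProj deg g s = 0 := by
  classical
  ext d
  rw [degProj_apply]
  split_ifs with hd
  · by_contra hne
    exact h (Finset.mem_image.2 ⟨d, Finsupp.mem_support_iff.2 hne, hd⟩)
  · rfl

lemma sum_degProj (s : (ι →₀ ℕ) →₀ K) : ∑ g ∈ degrees deg s, degProj deg g s = s := by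
  classical
  ext d
  rw [Finsupp.finsetSum_apply]
  simp only [degProj_apply]
  rw [Finset.sum_ite_eq]
  split_ifs with h
  · rfl
  · by_contra hne
    exact h (Finset.mem_image.2 ⟨d, Finsupp.mem_support_iff.2 (Ne.symm hne), rfl⟩)

/-- A subspace of `S^*` is homogeneous if it contains the homogeneous components of its
elements. -/
def IsGradedSub (A : Submodule K ((ι →₀ ℕ) →₀ K)) : Prop :=
  ∀ g, ∀ s ∈ A, degProj deg g s ∈ A

variable {deg}

lemma IsGradedSub.maxIdeal_mul {J : Ideal (MvPowerSeries ι K)} (h : IsGradedSub deg (dualSub J)) :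
    IsGradedSub deg (dualSub (maxIdeal K ι * J)) := by
  intro g s hs
  rw [mem_dualSub_maxIdeal_mul] at hs ⊢
  intro p hp
  rw [contract_degProj]
  exact h _ _ (hs p hp)

end Degree

end Duality

/-! ### The jacobiator as a 3-cochain and the Bianchi identity. -/

section Jacobiator

variable {K L G ι : Type*} [Field K] [LieRing L] [LieAlgebra K L] [AddCommGroup G]

section TwoCochain

variable (c : Cochain K L 2)

lemma cochain_add_left (x x' y : L) : c ![x + x', y] = c ![x, y] + c ![x', y] :=
  c.map_vecCons_add _ _ _

lemma cochain_smul_left (a : K) (x y : L) : c ![a • x, y] = a • c ![x, y] :=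
  c.map_vecCons_smul _ _ _

lemma cochain_swap (x y : L) : c ![y, x] = -c ![x, y] := by
  rw [← c.map_swap ![x, y] (i := 0) (j := 1) (by decide)]
  congr 1
  funext i
  fin_cases i <;> rfl

lemma cochain_self (x : L) : c ![x, x] = 0 :=
  c.map_eq_zero_of_eq _ (i := 0) (j := 1) rfl (by decide)

lemma cochain_add_right (x y y' : L) : c ![x, y + y'] = c ![x, y] + c ![x, y'] := by
  rw [cochain_swap, cochain_add_left, cochain_swap c x, cochain_swap c x]
  abel

lemma cochain_smul_right (a : K) (x y : L) : c ![x, a • y] = a • c ![x, y] := by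
  rw [cochain_swap, cochain_smul_left, cochain_swap c x, smul_neg, neg_neg]

/-- A `2`-cochain as a function of its second argument. -/
def cochainRight (x : L) : L →ₗ[K] L where
  toFun y := c ![x, y]
  map_add' := cochain_add_right c x
  map_smul' a y := cochain_smul_right c a x y

/-- A `2`-cochain as a function of its first argument. -/
def cochainLeft (y : L) : L →ₗ[K] L where
  toFun x := c ![x, y]
  map_add' x x' := cochain_add_left c x x' y
  map_smul' a x := cochain_smul_left c a x y

lemma cochainRight_apply (x y : L) : cochainRight c x y = c ![x, y] := rfl

lemma cochain_zero_left (y : L) : c ![0, y] = 0 := (cochainLeft c y).map_zero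

lemma cochain_neg_left (x y : L) : c ![-x, y] = -c ![x, y] := (cochainLeft c y).map_neg x

end TwoCochain

variable (α : (ι →₀ ℕ) → Cochain K L 2)

/-- The coefficients of the jacobiator are `3`-cochains. -/
def jacMap (d : ι →₀ ℕ) : Cochain K L 3 where
  toFun := jacobiator α d
  map_update_add' {inst} v i x y := by
    obtain rfl := Subsingleton.elim inst (instDecidableEqFin 3)
    simp only [jacobiator, ← Finset.sum_add_distrib]
    refine Finset.sum_congr rfl fun p _ => ?_
    fin_cases i <;>
    · simp [cochain_add_left, cochain_add_right]
      abel
  map_update_smul' {inst} v i a x := by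
    obtain rfl := Subsingleton.elim inst (instDecidableEqFin 3)
    simp only [jacobiator, Finset.smul_sum]
    refine Finset.sum_congr rfl fun p _ => ?_
    fin_cases i <;> simp [cochain_smul_left, cochain_smul_right]
  map_eq_zero_of_eq' v i j h hij := by
    refine Finset.sum_eq_zero fun p _ => ?_
    have key : ∀ x y, α p.1 ![α p.2 ![x, x], y] = 0 := fun x y => by
      rw [cochain_self, cochain_zero_left]
    have key' : ∀ x y z, α p.1 ![α p.2 ![x, y], z] + α p.1 ![α p.2 ![y, x], z] = 0 :=
      fun x y z => by
        rw [cochain_swap (α p.2) x y, cochain_neg_left, add_neg_cancel]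
    fin_cases i <;> fin_cases j <;> simp at hij h <;> rw [h] <;>
      simp only [key, key', zero_add, add_zero]

lemma jacMap_apply (d : ι →₀ ℕ) (v : Fin 3 → L) : jacMap α d v = jacobiator α d v := rfl

lemma delta_one_apply (c : Cochain K L 2) (v : Fin 3 → L) :
    delta 1 c v = c ![⁅v 0, v 1⁆, v 2] - c ![⁅v 0, v 2⁆, v 1] + c ![⁅v 1, v 2⁆, v 0]
      - ⁅v 0, c ![v 1, v 2]⁆ + ⁅v 1, c ![v 0, v 2]⁆ - ⁅v 2, c ![v 0, v 1]⁆ := by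
  have e : ∀ (x : L) (f : Fin 1 → L), (Fin.cons x f : Fin 2 → L) = ![x, f 0] := by
    intro x f; funext i; fin_cases i <;> rfl
  have e3 : ∀ f : Fin 2 → L, f = ![f 0, f 1] := by
    intro f; funext i; fin_cases i <;> rfl
  have i0 : Finset.Iic (0 : Fin 2) = {0} := by decide
  have i1 : Finset.Iic (1 : Fin 2) = {0, 1} := by decide
  change (∑ t : Fin 2, ∑ s ∈ Finset.Iic t, (-1 : ℤ) ^ ((s : ℕ) + (t : ℕ)) •
        c (Fin.cons ⁅v s.castSucc, v t.succ⁆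
          (fun i : Fin 1 => v (t.succ.succAbove (s.succAbove i))))) +
    ∑ u : Fin 3, (-1 : ℤ) ^ ((u : ℕ) + 1) • ⁅v u, c (fun i : Fin 2 => v (u.succAbove i))⁆ = _
  simp only [e, Fin.sum_univ_two, Fin.sum_univ_three, i0, i1]
  rw [e3 (fun i : Fin 2 => v (Fin.succAbove 0 i)), e3 (fun i : Fin 2 => v (Fin.succAbove 1 i)),
    e3 (fun i : Fin 2 => v (Fin.succAbove 2 i))]
  simp [Fin.succAbove, -lie_skew]
  abel

lemma delta_two_apply (γ : Cochain K L 3) (v : Fin 4 → L) :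
    delta 2 γ v = γ ![⁅v 0, v 1⁆, v 2, v 3] - γ ![⁅v 0, v 2⁆, v 1, v 3] + γ ![⁅v 0, v 3⁆, v 1, v 2]
      + γ ![⁅v 1, v 2⁆, v 0, v 3] - γ ![⁅v 1, v 3⁆, v 0, v 2] + γ ![⁅v 2, v 3⁆, v 0, v 1]
      - ⁅v 0, γ ![v 1, v 2, v 3]⁆ + ⁅v 1, γ ![v 0, v 2, v 3]⁆ - ⁅v 2, γ ![v 0, v 1, v 3]⁆
      + ⁅v 3, γ ![v 0, v 1, v 2]⁆ := by
  have e : ∀ (x : L) (f : Fin 2 → L), (Fin.cons x f : Fin 3 → L) = ![x, f 0, f 1] := by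
    intro x f; funext i; fin_cases i <;> rfl
  have e3 : ∀ f : Fin 3 → L, f = ![f 0, f 1, f 2] := by
    intro f; funext i; fin_cases i <;> rfl
  have i0 : Finset.Iic (0 : Fin 3) = {0} := by decide
  have i1 : Finset.Iic (1 : Fin 3) = {0, 1} := by decide
  have i2 : Finset.Iic (2 : Fin 3) = {0, 1, 2} := by decide
  change (∑ t : Fin 3, ∑ s ∈ Finset.Iic t, (-1 : ℤ) ^ ((s : ℕ) + (t : ℕ)) •
        γ (Fin.cons ⁅v s.castSucc, v t.succ⁆
          (fun i : Fin 2 => v (t.succ.succAbove (s.succAbove i))))) +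
    ∑ u : Fin 4, (-1 : ℤ) ^ ((u : ℕ) + 1) • ⁅v u, γ (fun i : Fin 3 => v (u.succAbove i))⁆ = _
  simp only [e, Fin.sum_univ_three, Fin.sum_univ_four, i0, i1, i2]
  rw [e3 (fun i : Fin 3 => v (Fin.succAbove 0 i)), e3 (fun i : Fin 3 => v (Fin.succAbove 1 i)),
    e3 (fun i : Fin 3 => v (Fin.succAbove 2 i)), e3 (fun i : Fin 3 => v (Fin.succAbove 3 i))]
  simp [Fin.succAbove, -lie_skew]
  abel

section Bianchi

open scoped Classical in
/-- The sum of `Ψ p b c` over all `p + b + c = d`. -/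
def tripleSum (d : ι →₀ ℕ) (Ψ : (ι →₀ ℕ) → (ι →₀ ℕ) → (ι →₀ ℕ) → L) : L :=
  ∑ x ∈ Finset.HasAntidiagonal.antidiagonal d,
    ∑ y ∈ Finset.HasAntidiagonal.antidiagonal x.2, Ψ x.1 y.1 y.2

lemma tripleSum_add (d : ι →₀ ℕ) (Ψ Ψ' : (ι →₀ ℕ) → (ι →₀ ℕ) → (ι →₀ ℕ) → L) :
    tripleSum d (fun p b c => Ψ p b c + Ψ' p b c) = tripleSum d Ψ + tripleSum d Ψ' := by
  simp only [tripleSum, Finset.sum_add_distrib]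

lemma tripleSum_neg (d : ι →₀ ℕ) (Ψ : (ι →₀ ℕ) → (ι →₀ ℕ) → (ι →₀ ℕ) → L) :
    tripleSum d (fun p b c => -Ψ p b c) = -tripleSum d Ψ := by
  simp only [tripleSum, Finset.sum_neg_distrib]

/-- Together with `tripleSum_swap_left` this gives every permutation of the three exponents. -/
lemma tripleSum_swap_right (d : ι →₀ ℕ) (Ψ : (ι →₀ ℕ) → (ι →₀ ℕ) → (ι →₀ ℕ) → L) :
    tripleSum d (fun p b c => Ψ p c b) = tripleSum d Ψ := by
  classical
  simp only [tripleSum]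
  refine Finset.sum_congr rfl fun x _ => ?_
  exact Finset.sum_nbij' Prod.swap Prod.swap (by simp [add_comm]) (by simp [add_comm])
    (by simp) (by simp) (by simp)

lemma tripleSum_swap_left (d : ι →₀ ℕ) (Ψ : (ι →₀ ℕ) → (ι →₀ ℕ) → (ι →₀ ℕ) → L) :
    tripleSum d (fun p b c => Ψ b p c) = tripleSum d Ψ := by
  classical
  simp only [tripleSum, Finset.sum_sigma']
  -- Exchanging `p` and `b` inside `p + (b + c)` is an involution, so the same map serves as its
  -- inverse.
  refine Finset.sum_nbij'
    (fun x => ⟨(x.2.1, x.1.1 + x.2.2), (x.1.1, x.2.2)⟩)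
    (fun x => ⟨(x.2.1, x.1.1 + x.2.2), (x.1.1, x.2.2)⟩) ?_ ?_ ?_ ?_ ?_
  · rintro ⟨⟨p, q⟩, ⟨b, c⟩⟩ h
    simp only [Finset.mem_sigma, Finset.HasAntidiagonal.mem_antidiagonal] at h ⊢
    exact ⟨by rw [← h.1, ← h.2]; abel, trivial⟩
  · rintro ⟨⟨p, q⟩, ⟨b, c⟩⟩ h
    simp only [Finset.mem_sigma, Finset.HasAntidiagonal.mem_antidiagonal] at h ⊢
    exact ⟨by rw [← h.1, ← h.2]; abel, trivial⟩
  · rintro ⟨⟨p, q⟩, ⟨b, c⟩⟩ h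
    simp only [Finset.mem_sigma, Finset.HasAntidiagonal.mem_antidiagonal] at h
    obtain ⟨-, rfl⟩ := h
    rfl
  · rintro ⟨⟨p, q⟩, ⟨b, c⟩⟩ h
    simp only [Finset.mem_sigma, Finset.HasAntidiagonal.mem_antidiagonal] at h
    obtain ⟨-, rfl⟩ := h
    rfl
  · rintro ⟨⟨p, q⟩, ⟨b, c⟩⟩ _
    rfl

/-- The differential of a `3`-cochain, with the bracket of `L` replaced by a `2`-cochain. -/
def twistedDelta (c : Cochain K L 2) (v : Fin 4 → L) : Cochain K L 3 →ₗ[K] L where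
  toFun γ := γ ![c ![v 0, v 1], v 2, v 3] - γ ![c ![v 0, v 2], v 1, v 3]
      + γ ![c ![v 0, v 3], v 1, v 2]
      + γ ![c ![v 1, v 2], v 0, v 3] - γ ![c ![v 1, v 3], v 0, v 2] + γ ![c ![v 2, v 3], v 0, v 1]
      - c ![v 0, γ ![v 1, v 2, v 3]] + c ![v 1, γ ![v 0, v 2, v 3]] - c ![v 2, γ ![v 0, v 1, v 3]]
      + c ![v 3, γ ![v 0, v 1, v 2]]
  map_add' γ γ' := by
    simp only [AlternatingMap.add_apply, cochain_add_right]
    abel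
  map_smul' a γ := by
    simp only [AlternatingMap.smul_apply, cochain_smul_right, smul_add, smul_sub,
      RingHom.id_apply]

lemma twistedDelta_apply (c : Cochain K L 2) (v : Fin 4 → L) (γ : Cochain K L 3) :
    twistedDelta c v γ =
      γ ![c ![v 0, v 1], v 2, v 3] - γ ![c ![v 0, v 2], v 1, v 3] + γ ![c ![v 0, v 3], v 1, v 2]
      + γ ![c ![v 1, v 2], v 0, v 3] - γ ![c ![v 1, v 3], v 0, v 2] + γ ![c ![v 2, v 3], v 0, v 1]
      - c ![v 0, γ ![v 1, v 2, v 3]] + c ![v 1, γ ![v 0, v 2, v 3]] - c ![v 2, γ ![v 0, v 1, v 3]]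
      + c ![v 3, γ ![v 0, v 1, v 2]] := rfl

lemma delta_two_eq_twistedDelta {c : Cochain K L 2} (hc : ∀ l l' : L, c ![l, l'] = ⁅l, l'⁆)
    (γ : Cochain K L 3) (v : Fin 4 → L) : delta 2 γ v = twistedDelta c v γ := by
  rw [delta_two_apply, twistedDelta_apply]
  simp only [hc]

/-- The nested brackets `{{{x, y}, z}, w}`, coefficient at `x^d`. -/
def nested (d : ι →₀ ℕ) (x y z w : L) : L :=
  tripleSum d fun p b c => α b ![α c ![α p ![x, y], z], w]

/-- The brackets `{{x, y}, {z, w}}`, coefficient at `x^d`. -/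
def bracketPair (d : ι →₀ ℕ) (x y z w : L) : L :=
  tripleSum d fun p b c => α b ![α c ![x, y], α p ![z, w]]

lemma nested_swap (d : ι →₀ ℕ) (x y z w : L) : nested α d y x z w = -nested α d x y z w := by
  rw [nested, nested, ← tripleSum_neg]
  congr 1
  funext p b c
  rw [cochain_swap _ x y, cochain_neg_left, cochain_neg_left]

/-- Skew-symmetry of the outer bracket gives the sign; the exponents of the two inner brackets are
exchanged by a product of three adjacent transpositions. -/
lemma bracketPair_swap (d : ι →₀ ℕ) (x y z w : L) :
    bracketPair α d z w x y = -bracketPair α d x y z w := by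
  rw [bracketPair, bracketPair, ← tripleSum_neg, ← tripleSum_swap_left, ← tripleSum_swap_right,
    ← tripleSum_swap_left]
  congr 1
  funext p b c
  rw [cochain_swap]

-- The three terms are those of the cyclic sum; the last, {{w,{x,y}},z}, becomes a nested bracket by
-- skew-symmetry.
open scoped Classical in
lemma sum_jacMap_bracket (d : ι →₀ ℕ) (x y z w : L) :
    ∑ p ∈ Finset.HasAntidiagonal.antidiagonal d, jacMap α p.2 ![α p.1 ![x, y], z, w] =
      nested α d x y z w + bracketPair α d z w x y - nested α d x y w z := by
  rw [sub_eq_add_neg, nested, nested, bracketPair, ← tripleSum_neg, ← tripleSum_add,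
    ← tripleSum_add]
  refine Finset.sum_congr rfl fun p _ => ?_
  rw [jacMap_apply, jacobiator]
  refine Finset.sum_congr rfl fun q _ => ?_
  change _ + _ + α q.1 ![α q.2 ![w, α p.1 ![x, y]], z] = _
  rw [cochain_swap (α q.2) _ w, cochain_neg_left]
  rfl

open scoped Classical in
lemma sum_bracket_jacMap (d : ι →₀ ℕ) (x y z w : L) :
    ∑ p ∈ Finset.HasAntidiagonal.antidiagonal d, α p.1 ![w, jacMap α p.2 ![x, y, z]] =
      -(nested α d x y z w + nested α d y z x w + nested α d z x y w) := by
  -- Here the outermost bracket carries the first exponent, so the exponents are permuted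
  -- cyclically.
  have key : ∀ x y z, nested α d x y z w =
      tripleSum d fun p b c => α p ![α b ![α c ![x, y], z], w] := fun x y z => by
    rw [nested, ← tripleSum_swap_right, ← tripleSum_swap_left, ← tripleSum_swap_right,
      ← tripleSum_swap_left]
  rw [key, key, key, ← tripleSum_add, ← tripleSum_add, ← tripleSum_neg]
  refine Finset.sum_congr rfl fun p _ => ?_
  rw [jacMap_apply, jacobiator, ← cochainRight_apply, map_sum]
  refine Finset.sum_congr rfl fun q _ => ?_
  rw [cochainRight_apply, cochain_swap, cochain_add_left, cochain_add_left]
  rfl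

open scoped Classical in
/-- The Bianchi identity for a skew-symmetric bracket with power series coefficients. -/
lemma sum_twistedDelta_jacMap (d : ι →₀ ℕ) (v : Fin 4 → L) :
    ∑ p ∈ Finset.HasAntidiagonal.antidiagonal d, twistedDelta (α p.1) v (jacMap α p.2) = 0 := by
  simp only [twistedDelta_apply, Finset.sum_add_distrib, Finset.sum_sub_distrib,
    sum_jacMap_bracket, sum_bracket_jacMap]
  -- With the arguments in a common order, the six products of brackets cancel in pairs, and each of
  -- the twelve nested brackets occurs twice with opposite signs.
  rw [bracketPair_swap α d (v 0) (v 1), bracketPair_swap α d (v 0) (v 2),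
    bracketPair_swap α d (v 0) (v 3), nested_swap α d (v 1) (v 3), nested_swap α d (v 0) (v 3),
    nested_swap α d (v 0) (v 2), nested_swap α d (v 0) (v 3)]
  abel

end Bianchi

end Jacobiator

/-! ### Homogeneous cochains and the independence of the pieces of H^3. -/

section GradedCochains

variable {K L G ι : Type*} [Field K] [LieRing L] [LieAlgebra K L] [AddCommGroup G]

lemma cochain_sum_apply {q : ℕ} {τ : Type*} (Θ : Finset τ) (c : τ → Cochain K L q)
    (v : Fin q → L) : (∑ t ∈ Θ, c t) v = ∑ t ∈ Θ, c t v := by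
  classical
  induction Θ using Finset.induction_on with
  | empty => rfl
  | insert t Θ ht ih => rw [Finset.sum_insert ht, Finset.sum_insert ht, AlternatingMap.add_apply, ih]

/-- The differential on `2`-cochains, with values in `3`-cochains. -/
def deltaOne (c : Cochain K L 2) : Cochain K L 3 where
  toFun := delta 1 c
  map_update_add' {inst} v i x y := by
    obtain rfl := Subsingleton.elim inst (instDecidableEqFin 3)
    simp only [delta_one_apply]
    fin_cases i <;>
    · simp [cochain_add_left, cochain_add_right, -lie_skew]
      abel
  map_update_smul' {inst} v i a x := by
    obtain rfl := Subsingleton.elim inst (instDecidableEqFin 3)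
    simp only [delta_one_apply]
    fin_cases i <;>
    simp [cochain_smul_left, cochain_smul_right, -lie_skew, smul_sub]
  map_eq_zero_of_eq' v i j h hij := by
    rw [delta_one_apply]
    fin_cases i <;> fin_cases j <;> simp at hij h <;> rw [h] <;>
      simp [cochain_self, cochain_zero_left, -lie_skew] <;>
    · rw [← lie_skew, cochain_neg_left, cochain_swap c (v 1), lie_neg]
      abel

lemma deltaOne_apply (c : Cochain K L 2) (v : Fin 3 → L) : deltaOne c v = delta 1 c v := rfl

lemma deltaOne_sum {τ : Type*} (Θ : Finset τ) (c : τ → Cochain K L 2) :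
    deltaOne (∑ t ∈ Θ, c t) = ∑ t ∈ Θ, deltaOne (c t) := by
  ext v
  rw [deltaOne_apply, map_sum, Finset.sum_apply, cochain_sum_apply]
  rfl

variable {𝒜 : G → Submodule K L}

lemma deltaOne_mem_homCochain
    (hbracket : ∀ (g h : G) (x y : L), x ∈ 𝒜 g → y ∈ 𝒜 h → ⁅x, y⁆ ∈ 𝒜 (g + h))
    {g : G} {c : Cochain K L 2} (hc : c ∈ homCochain 𝒜 2 g) :
    deltaOne c ∈ homCochain 𝒜 3 g := by
  have hc2 : ∀ (e e' : G) (x y : L), x ∈ 𝒜 e → y ∈ 𝒜 e' → c ![x, y] ∈ 𝒜 (e + e' - g) := by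
    intro e e' x y hx hy
    have := hc ![e, e'] ![x, y] (by intro i; fin_cases i <;> assumption)
    rwa [Fin.sum_univ_two] at this
  intro e v hv
  rw [deltaOne_apply, delta_one_apply, Fin.sum_univ_three]
  have cast : ∀ {a b : G} {x : L}, x ∈ 𝒜 a → a = b → x ∈ 𝒜 b := fun hx h => h ▸ hx
  refine sub_mem (add_mem (sub_mem (add_mem (sub_mem ?_ ?_) ?_) ?_) ?_) ?_
  · exact cast (hc2 _ _ _ _ (hbracket _ _ _ _ (hv 0) (hv 1)) (hv 2)) (by abel)
  · exact cast (hc2 _ _ _ _ (hbracket _ _ _ _ (hv 0) (hv 2)) (hv 1)) (by abel)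
  · exact cast (hc2 _ _ _ _ (hbracket _ _ _ _ (hv 1) (hv 2)) (hv 0)) (by abel)
  · exact cast (hbracket _ _ _ _ (hv 0) (hc2 _ _ _ _ (hv 1) (hv 2))) (by abel)
  · exact cast (hbracket _ _ _ _ (hv 1) (hc2 _ _ _ _ (hv 0) (hv 2))) (by abel)
  · exact cast (hbracket _ _ _ _ (hv 2) (hc2 _ _ _ _ (hv 0) (hv 1))) (by abel)

/-- It suffices to evaluate on tuples of homogeneous basis vectors of L. There the cochains of
different degrees take values in different pieces of L, since g ↦ e_1 + ... + e_q - g is injective.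
-/
lemma iSupIndep_homCochain [DecidableEq G] (h𝒜 : DirectSum.IsInternal 𝒜) (q : ℕ) :
    iSupIndep (homCochain 𝒜 q) := by
  rw [iSupIndep_iff_finsetSum_eq_zero_imp_eq_zero]
  intro Θ φ hφ h0 g hg
  let B := h𝒜.collectedBasis fun g => Module.Basis.ofVectorSpace K (𝒜 g)
  apply AlternatingMap.coe_multilinearMap_injective
  refine Module.Basis.ext_multilinear (fun _ => B) fun v => ?_
  have hB : ∀ i, B (v i) ∈ 𝒜 (v i).1 := fun i => h𝒜.collectedBasis_mem _ _
  have hind := (iSupIndep_iff_finsetSum_eq_zero_imp_eq_zero _).1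
    (h𝒜.submodule_iSupIndep.comp (sub_right_injective (b := ∑ i, (v i).1)))
    Θ (fun g => φ g fun i => B (v i)) (fun g hg => hφ g hg _ _ hB)
  refine hind ?_ g hg
  rw [← cochain_sum_apply, h0]
  rfl

lemma mem_coboundary_one {φ : Cochain K L 3} :
    φ ∈ coboundary 𝒜 1 ↔ ∃ c ∈ gradedCochain 𝒜 2, deltaOne c = φ :=
  exists_congr fun _ => and_congr_right fun _ =>
    ⟨fun h => AlternatingMap.ext fun v => congrFun h v, fun h => h ▸ rfl⟩

/-- The homogeneous components of a coboundary are coboundaries. -/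
lemma mem_coboundary_of_sum_mem [DecidableEq G] (h𝒜 : DirectSum.IsInternal 𝒜)
    (hbracket : ∀ (g h : G) (x y : L), x ∈ 𝒜 g → y ∈ 𝒜 h → ⁅x, y⁆ ∈ 𝒜 (g + h))
    {Θ : Finset G} {z : G → Cochain K L 3} (hz : ∀ g ∈ Θ, z g ∈ homCochain 𝒜 3 g)
    (h : ∑ g ∈ Θ, z g ∈ coboundary 𝒜 1) {g : G} (hg : g ∈ Θ) : z g ∈ coboundary 𝒜 1 := by
  obtain ⟨c, hc, hcz⟩ := mem_coboundary_one.1 h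
  obtain ⟨f, hf, rfl⟩ := (Submodule.mem_iSup_iff_exists_finsupp _ _).1 hc
  refine mem_coboundary_one.2 ⟨f g, Submodule.mem_iSup_of_mem g (hf g), ?_⟩
  -- The two homogeneous decompositions of the same cochain, by the `z g` and by the `deltaOne (f
  -- g)`, are compared on a common finite set of degrees, with missing components set to zero.
  have hind := (iSupIndep_iff_finsetSum_eq_zero_imp_eq_zero _).1 (iSupIndep_homCochain h𝒜 3)
    (Θ ∪ f.support) (fun g => deltaOne (f g) - if g ∈ Θ then z g else 0) ?_ ?_ g
    (Finset.mem_union_left _ hg)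
  · rw [if_pos hg] at hind
    exact sub_eq_zero.1 hind
  · intro g _
    refine sub_mem (deltaOne_mem_homCochain hbracket (hf g)) ?_
    split_ifs with hg
    · exact hz g hg
    · exact zero_mem _
  · rw [Finset.sum_sub_distrib, Finset.sum_ite_mem, Finset.union_inter_cancel_left, ← hcz,
      ← deltaOne_sum, Finsupp.sum, sub_eq_zero]
    congr 1
    symm
    refine Finset.sum_subset Finset.subset_union_right fun g _ hg => ?_
    exact Finsupp.notMem_support_iff.1 hg

/-- If homogeneous classes sum to zero, the sum of homogeneous representatives is a coboundary, and
then so is each of them. -/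
lemma iSupIndep_H3piece [DecidableEq G] (h𝒜 : DirectSum.IsInternal 𝒜)
    (hbracket : ∀ (g h : G) (x y : L), x ∈ 𝒜 g → y ∈ 𝒜 h → ⁅x, y⁆ ∈ 𝒜 (g + h)) :
    iSupIndep (H3piece 𝒜) := by
  rw [iSupIndep_iff_finsetSum_eq_zero_imp_eq_zero]
  intro Θ w hw h0 g hg
  have hex : ∀ g, ∃ z : cocycle 𝒜 2, g ∈ Θ → (z : Cochain K L 3) ∈ homCochain 𝒜 3 g ∧
      Submodule.Quotient.mk z = w g := by
    intro g
    by_cases hg : g ∈ Θ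
    · obtain ⟨z, hz, h⟩ := hw g hg
      exact ⟨z, fun _ => ⟨hz, h⟩⟩
    · exact ⟨0, fun h => absurd h hg⟩
  choose z hz using hex
  rw [← (hz g hg).2, Submodule.Quotient.mk_eq_zero]
  refine mem_coboundary_of_sum_mem h𝒜 hbracket (Θ := Θ) (z := fun g => (z g : Cochain K L 3))
    (fun g hg => (hz g hg).1) ?_ hg
  have h1 : ((coboundary 𝒜 1).submoduleOf (cocycle 𝒜 2)).mkQ (∑ g ∈ Θ, z g) = 0 := by
    rw [map_sum, ← h0]
    exact Finset.sum_congr rfl fun g hg => (hz g hg).2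
  rw [Submodule.mkQ_apply, Submodule.Quotient.mk_eq_zero] at h1
  have h2 : ((∑ g ∈ Θ, z g : cocycle 𝒜 2) : Cochain K L 3) ∈ coboundary 𝒜 1 := h1
  rwa [AddSubmonoidClass.coe_finsetSum] at h2

end GradedCochains

/-! ### Values of the jacobiator on S^*: closedness and degree. -/

section JacobiatorValues

variable {K L G ι : Type*} [Field K] [LieRing L] [LieAlgebra K L] [AddCommGroup G]
variable (α : (ι →₀ ℕ) → Cochain K L 2)

/-- The value of the jacobiator on an element of `S^*`, as a `3`-cochain. -/
def jacValue : ((ι →₀ ℕ) →₀ K) →ₗ[K] Cochain K L 3 :=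
  Finsupp.linearCombination K (jacMap α)

lemma jacobiatorAt_eq (s : (ι →₀ ℕ) →₀ K) : jacobiatorAt α s = fun v => jacValue α s v := by
  funext v
  simp only [jacobiatorAt, pair, jacValue, Finsupp.linearCombination_apply, Finsupp.sum,
    Finset.sum_apply, cochain_sum_apply, Pi.smul_apply, AlternatingMap.smul_apply,
    jacMap_apply]

lemma jacobiatorAt_eq_zero_iff (s : (ι →₀ ℕ) →₀ K) :
    jacobiatorAt α s = 0 ↔ jacValue α s = 0 := by
  rw [jacobiatorAt_eq]
  exact ⟨fun h => AlternatingMap.ext fun v => congrFun h v, fun h => by rw [h]; rfl⟩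

lemma jacValue_mem_coboundary_iff {𝒜 : G → Submodule K L} (s : (ι →₀ ℕ) →₀ K) :
    jacValue α s ∈ coboundary 𝒜 1 ↔
      ∃ c ∈ gradedCochain 𝒜 2, delta 1 c = jacobiatorAt α s := by
  rw [jacobiatorAt_eq]
  rfl

/-- If the jacobiator vanishes on the contractions of `s` with nontrivial monomials, then its
value on `s` is closed. -/
lemma delta_jacValue_eq_zero (h0 : ∀ l l' : L, α 0 ![l, l'] = ⁅l, l'⁆) {s : (ι →₀ ℕ) →₀ K}
    (hs : ∀ p ≠ 0, jacValue α (contract p s) = 0) : delta 2 (jacValue α s) = 0 := by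
  classical
  funext v
  rw [delta_two_eq_twistedDelta h0]
  -- Evaluated on `s`, the Bianchi identity is a sum over the contractions of `s`. Only `p = 0`
  -- survives, and `α 0` is the bracket of L.
  have h := linearCombination_antidiagonal (fun p q => twistedDelta (α p) v (jacMap α q)) s
  have hz : (fun d => ∑ x ∈ Finset.HasAntidiagonal.antidiagonal d,
      twistedDelta (α x.1) v (jacMap α x.2)) = fun _ => (0 : L) := by
    funext d
    convert sum_twistedDelta_jacMap α d v
  have key : ∀ p t, Finsupp.linearCombination K (fun q => twistedDelta (α p) v (jacMap α q)) t =
      twistedDelta (α p) v (jacValue α t) := by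
    intro p t
    rw [jacValue, Finsupp.linearCombination_apply, Finsupp.linearCombination_apply,
      map_finsuppSum]
    simp only [map_smul]
  simp only [hz, key] at h
  rw [Finset.sum_eq_single 0, contract_zero] at h
  · rw [← h, Finsupp.linearCombination_apply]
    simp
  · intro p _ hp
    rw [hs p hp, map_zero]
  · intro h
    rw [contract_eq_zero h, map_zero, map_zero]

variable {α} {𝒜 : G → Submodule K L} {deg : ι → G}

lemma jacMap_mem_homCochain (hα : ∀ d, α d ∈ homCochain 𝒜 2 (monDeg deg d)) (d : ι →₀ ℕ) :
    jacMap α d ∈ homCochain 𝒜 3 (monDeg deg d) := by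
  have h2 : ∀ (d : ι →₀ ℕ) (e e' : G) (x y : L), x ∈ 𝒜 e → y ∈ 𝒜 e' →
      α d ![x, y] ∈ 𝒜 (e + e' - monDeg deg d) := by
    intro d e e' x y hx hy
    have := hα d ![e, e'] ![x, y] (by intro i; fin_cases i <;> assumption)
    rwa [Fin.sum_univ_two] at this
  intro e v hv
  classical
  rw [jacMap_apply, jacobiator, Fin.sum_univ_three]
  have cast : ∀ {a b : G} {x : L}, x ∈ 𝒜 a → a = b → x ∈ 𝒜 b := fun hx h => h ▸ hx
  refine sum_mem fun p hp => ?_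
  rw [Finset.HasAntidiagonal.mem_antidiagonal] at hp
  subst hp
  rw [monDeg_add]
  refine add_mem (add_mem ?_ ?_) ?_
  · exact cast (h2 _ _ _ _ _ (h2 _ _ _ _ _ (hv 0) (hv 1)) (hv 2)) (by abel)
  · exact cast (h2 _ _ _ _ _ (h2 _ _ _ _ _ (hv 1) (hv 2)) (hv 0)) (by abel)
  · exact cast (h2 _ _ _ _ _ (h2 _ _ _ _ _ (hv 2) (hv 0)) (hv 1)) (by abel)

lemma jacValue_degProj_mem (hα : ∀ d, α d ∈ homCochain 𝒜 2 (monDeg deg d)) (g : G)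
    (s : (ι →₀ ℕ) →₀ K) : jacValue α (degProj deg g s) ∈ homCochain 𝒜 3 g := by
  classical
  rw [jacValue, Finsupp.linearCombination_apply, Finsupp.sum]
  refine Submodule.sum_mem _ fun d hd => Submodule.smul_mem _ _ ?_
  rw [Finsupp.mem_support_iff, degProj_apply, ne_eq, ite_eq_right_iff, Classical.not_imp] at hd
  exact hd.1 ▸ jacMap_mem_homCochain hα d

lemma sum_jacValue_degProj (s : (ι →₀ ℕ) →₀ K) :
    ∑ g ∈ degrees deg s, jacValue α (degProj deg g s) = jacValue α s := by
  rw [← map_sum, sum_degProj]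

lemma jacValue_mem_gradedCochain (hα : ∀ d, α d ∈ homCochain 𝒜 2 (monDeg deg d))
    (s : (ι →₀ ℕ) →₀ K) : jacValue α s ∈ gradedCochain 𝒜 3 := by
  rw [← sum_jacValue_degProj (deg := deg)]
  exact sum_mem fun g _ => Submodule.mem_iSup_of_mem g (jacValue_degProj_mem hα g s)

lemma jacValue_degProj_mem_coboundary [DecidableEq G] (h𝒜 : DirectSum.IsInternal 𝒜)
    (hbracket : ∀ (g h : G) (x y : L), x ∈ 𝒜 g → y ∈ 𝒜 h → ⁅x, y⁆ ∈ 𝒜 (g + h))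
    (hα : ∀ d, α d ∈ homCochain 𝒜 2 (monDeg deg d)) {s : (ι →₀ ℕ) →₀ K}
    (hs : jacValue α s ∈ coboundary 𝒜 1) (g : G) :
    jacValue α (degProj deg g s) ∈ coboundary 𝒜 1 := by
  by_cases hg : g ∈ degrees deg s
  · rw [← sum_jacValue_degProj (deg := deg)] at hs
    exact mem_coboundary_of_sum_mem h𝒜 hbracket (fun g _ => jacValue_degProj_mem hα g s) hs hg
  · rw [degProj_eq_zero deg hg, map_zero]
    exact zero_mem _

end JacobiatorValues

/-! ### Locally finite generation of closed ideals. -/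

section Generation

variable {K ι : Type*} [Field K]

/-- An ideal of power series is closed if it is the annihilator of its annihilator in `S^*`. -/
def IsClosedIdeal (I : Ideal (MvPowerSeries ι K)) : Prop :=
  ∀ f, (∀ s ∈ dualSub I, evalAt f s = 0) → f ∈ I

lemma isClosedIdeal_of_mem_iff {I : Ideal (MvPowerSeries ι K)}
    {A : Submodule K ((ι →₀ ℕ) →₀ K)} (h : ∀ f, f ∈ I ↔ ∀ s ∈ A, evalAt f s = 0) :
    IsClosedIdeal I := by
  intro f hf
  rw [dualSub_eq_of_mem_iff h] at hf
  exact (h f).2 hf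

variable {T : Set (MvPowerSeries ι K)} {I : Ideal (MvPowerSeries ι K)}

open scoped Classical in
/-- The elements of a locally finite set which are relevant for the coefficients of its multiples
at `x^d`. -/
lemma exists_finset_of_locallyFinite (hT : ∀ d, {t ∈ T | MvPowerSeries.coeff d t ≠ 0}.Finite)
    (D : Finset (ι →₀ ℕ)) : ∃ Θ : Finset (MvPowerSeries ι K), ↑Θ ⊆ T ∧
      (∀ d ∈ D, ∀ x ∈ Finset.HasAntidiagonal.antidiagonal d, (hT x.2).toFinset ⊆ Θ) ∧
      ∀ (a : MvPowerSeries ι K → MvPowerSeries ι K), ∀ d ∈ D,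
        ∑ᶠ t ∈ T, MvPowerSeries.coeff d (a t * t) =
          ∑ t ∈ Θ, MvPowerSeries.coeff d (a t * t) := by
  refine ⟨D.biUnion fun d => (Finset.HasAntidiagonal.antidiagonal d).biUnion
    fun x => (hT x.2).toFinset, ?_, ?_, ?_⟩
  · intro t ht
    simp only [Finset.coe_biUnion, Set.mem_iUnion, Finset.mem_coe, Set.Finite.mem_toFinset] at ht
    obtain ⟨_, _, _, _, h⟩ := ht
    exact h.1
  · intro d hd x hx t ht
    exact Finset.mem_biUnion.2 ⟨d, hd, Finset.mem_biUnion.2 ⟨x, hx, ht⟩⟩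
  · intro a d hd
    refine finsum_mem_eq_sum_of_inter_support_eq _ ?_
    ext t
    simp only [Set.mem_inter_iff, Function.mem_support, Finset.coe_biUnion, Set.mem_iUnion,
      Finset.mem_coe, Set.Finite.mem_toFinset]
    refine and_congr_left fun hne => ⟨fun ht => ?_, fun ⟨_, _, _, _, h⟩ => h.1⟩
    rw [MvPowerSeries.coeff_mul] at hne
    obtain ⟨x, hx, hxne⟩ := Finset.exists_ne_zero_of_sum_ne_zero hne
    exact ⟨d, hd, x, hx, ht, right_ne_zero_of_mul hxne⟩

/-- An element of S^* sees only finitely many monomials, so on it the infinite sum agrees with a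
finite partial sum, which lies in `I`. -/
lemma mem_of_eq_finsum (hI : IsClosedIdeal I)
    (hT : ∀ d, {t ∈ T | MvPowerSeries.coeff d t ≠ 0}.Finite) (hTI : T ⊆ I)
    {f : MvPowerSeries ι K} {a : MvPowerSeries ι K → MvPowerSeries ι K}
    (hf : ∀ d, MvPowerSeries.coeff d f = ∑ᶠ t ∈ T, MvPowerSeries.coeff d (a t * t)) : f ∈ I := by
  refine hI f fun s hs => ?_
  obtain ⟨Θ, hΘ, -, h⟩ := exists_finset_of_locallyFinite hT s.support
  rw [evalAt_congr (h := ∑ t ∈ Θ, a t * t) fun d hd => by rw [hf, h a d hd, map_sum]]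
  exact hs _ (sum_mem fun t ht => I.mul_mem_left _ (hTI (hΘ ht)))

/-- A locally finite set of power series formally generates a closed ideal if the annihilator of
the ideal is the set of the elements of `S^*` whose contractions are annihilated by the set. -/
lemma formallyGenerates_of_mem_dualSub_iff (hI : IsClosedIdeal I)
    (hT : ∀ d, {t ∈ T | MvPowerSeries.coeff d t ≠ 0}.Finite)
    (hTI : ∀ s, s ∈ dualSub I ↔ ∀ t ∈ T, ∀ p, evalAt t (contract p s) = 0) :
    FormallyGenerates T I := by
  classical
  have hsub : T ⊆ I := fun t ht => hI t fun s hs => by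
    simpa only [contract_zero] using (hTI s).1 hs t ht 0
  refine ⟨hT, fun f => ⟨fun hf => ?_, fun ⟨a, ha⟩ => mem_of_eq_finsum hI hT hsub ha⟩⟩
  -- `Φ` collects the values of all `t ∈ T` on all contractions of `s`; local finiteness is what
  -- makes this family finitely supported.
  let Ψ : (ι →₀ ℕ) → (ι →₀ ℕ) → (MvPowerSeries ι K × (ι →₀ ℕ) →₀ K) := fun p q =>
    ∑ t ∈ (hT q).toFinset, Finsupp.single (t, p) (MvPowerSeries.coeff q t)
  let Φ : ((ι →₀ ℕ) →₀ K) →ₗ[K] (MvPowerSeries ι K × (ι →₀ ℕ) →₀ K) :=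
    Finsupp.linearCombination K fun d =>
      ∑ x ∈ Finset.HasAntidiagonal.antidiagonal d, Ψ x.1 x.2
  have hΨ : ∀ p' q p, ∀ t ∈ T, Ψ p' q (t, p) = if p' = p then MvPowerSeries.coeff q t else 0 := by
    intro p' q p t ht
    simp only [Ψ, Finsupp.finsetSum_apply, Finsupp.single_apply, Prod.mk.injEq]
    by_cases hp : p' = p
    · simp only [hp, and_true, if_true]
      rw [Finset.sum_ite_eq']
      split_ifs with h
      · rfl
      · by_contra hne
        exact h ((hT q).mem_toFinset.2 ⟨ht, Ne.symm hne⟩)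
    · simp [hp]
  have hΦ : ∀ s, ∀ t ∈ T, ∀ p, Φ s (t, p) = evalAt t (contract p s) := by
    intro s t ht p
    simp only [Φ]
    rw [linearCombination_antidiagonal, Finsupp.finsetSum_apply]
    simp only [Finsupp.linearCombination_apply, Finsupp.sum, Finsupp.finsetSum_apply,
      Finsupp.smul_apply, hΨ _ _ _ t ht]
    rw [Finset.sum_eq_single p]
    · simp only [if_true]
      rfl
    · intro p' _ hp'
      simp [hp']
    · intro hp
      rw [contract_eq_zero hp]
      simp
  have hker : LinearMap.ker Φ ≤ LinearMap.ker (evalLin f) := by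
    intro s hs
    rw [LinearMap.mem_ker] at hs ⊢
    refine (hTI s).2 (fun t ht p => ?_) f hf
    rw [← hΦ s t ht p, hs, Finsupp.zero_apply]
  -- Since `f` vanishes on the kernel of `Φ`, it factors as `γ ∘ Φ`; the values of `γ` on the basis
  -- vectors `(t, p)` are the coefficients of the multipliers `a t`.
  obtain ⟨γ, hγ⟩ : evalLin f ∈ LinearMap.range Φ.dualMap := by
    rw [LinearMap.range_dualMap_eq_dualAnnihilator_ker, Submodule.mem_dualAnnihilator]
    exact fun s hs => hker hs
  refine ⟨fun t => ofCoeff fun p => γ (Finsupp.single (t, p) 1), fun d => ?_⟩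
  have h1 : MvPowerSeries.coeff d f = γ (Φ (Finsupp.single d 1)) := by
    rw [← LinearMap.dualMap_apply, hγ, evalLin_apply, evalAt_single, one_mul]
  rw [h1]
  simp only [Φ, Ψ]
  rw [Finsupp.linearCombination_single, one_smul, map_sum]
  obtain ⟨Θ, hΘ, hsub, hsum⟩ := exists_finset_of_locallyFinite hT {d}
  rw [hsum _ d (Finset.mem_singleton_self d)]
  simp only [MvPowerSeries.coeff_mul, coeff_ofCoeff]
  rw [Finset.sum_comm]
  refine Finset.sum_congr rfl fun x hx => ?_
  rw [map_sum]
  have hx' := hsub d (Finset.mem_singleton_self d) x (by convert hx)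
  rw [← Finset.sum_subset hx']
  · refine Finset.sum_congr rfl fun t _ => ?_
    rw [← mul_one (MvPowerSeries.coeff x.2 t), ← smul_eq_mul, ← Finsupp.smul_single, map_smul,
      smul_eq_mul, smul_eq_mul, mul_one, mul_comm]
  · intro t ht hne
    rw [Set.Finite.mem_toFinset] at hne
    by_cases h0 : MvPowerSeries.coeff x.2 t = 0
    · rw [h0, mul_zero]
    · exact absurd ⟨hΘ ht, h0⟩ hne

lemma FormallyGenerates.subset (h : FormallyGenerates T I) : T ⊆ I := by
  classical
  intro t ht
  refine (h.2 t).2 ⟨fun u => if u = t then 1 else 0, fun d => ?_⟩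
  rw [finsum_eq_single _ t fun u hu => by simp [hu]]
  simp [ht]

lemma FormallyGenerates.eq_span (h : FormallyGenerates T I) (hfin : T.Finite) :
    I = Ideal.span T := by
  refine le_antisymm (fun f hf => ?_) (Ideal.span_le.2 h.subset)
  obtain ⟨a, ha⟩ := (h.2 f).1 hf
  have : f = ∑ t ∈ hfin.toFinset, a t * t := by
    ext d
    rw [ha d, map_sum, finsum_mem_eq_finite_toFinset_sum _ hfin]
  rw [this]
  exact sum_mem fun t ht => Ideal.mul_mem_left _ _ (Ideal.subset_span (hfin.mem_toFinset.1 ht))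

lemma FormallyGenerates.topologicallyGenerates (h : FormallyGenerates T I) (hI : IsClosedIdeal I)
    {C : Set (MvPowerSeries ι K)} (hTC : T ⊆ C) (hCI : C ⊆ I) : TopologicallyGenerates C I := by
  intro f
  constructor
  · intro hf D
    obtain ⟨a, ha⟩ := (h.2 f).1 hf
    obtain ⟨Θ, hΘ, -, hsum⟩ := exists_finset_of_locallyFinite h.1 D
    refine ⟨∑ t ∈ Θ, a t * t, sum_mem fun t ht =>
      Ideal.mul_mem_left _ _ (Ideal.subset_span (hTC (hΘ ht))), fun d hd => ?_⟩
    rw [ha, hsum a d hd, map_sum]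
  · intro hf
    refine hI f fun s hs => ?_
    obtain ⟨u, hu, hfu⟩ := hf s.support
    rw [evalAt_congr hfu]
    exact hs u (Ideal.span_le.2 hCI hu)

end Generation

/-- Coordinates of independent subspaces, extended to the ambient space. -/
lemma exists_coordinates {K G H : Type*} [Field K] [AddCommGroup H] [Module K H]
    {W : G → Submodule K H} (hW : iSupIndep W) :
    ∃ φ : ∀ g, Module.Basis.ofVectorSpaceIndex K (W g) → Module.Dual K H,
      (∀ g j, ∀ g' ≠ g, ∀ w ∈ W g', φ g j w = 0) ∧
      (∀ g, ∀ w ∈ W g, {j | φ g j w ≠ 0}.Finite) ∧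
      (∀ g, ∀ w ∈ W g, (∀ j, φ g j w = 0) → w = 0) := by
  have hex : ∀ g, ∃ r : H →ₗ[K] W g, (∀ w : W g, r w = w) ∧ ∀ g' ≠ g, ∀ w ∈ W g', r w = 0 := by
    intro g
    -- Independence makes `W g` inject into the quotient by the other subspaces; a left inverse
    -- there is a projection to `W g` that kills the others.
    obtain ⟨r, hr⟩ := LinearMap.exists_leftInverse_of_injective
      ((⨆ j ≠ g, W j).mkQ ∘ₗ (W g).subtype) (by
        rw [LinearMap.ker_eq_bot']
        intro w hw
        rw [LinearMap.comp_apply, Submodule.mkQ_apply, Submodule.Quotient.mk_eq_zero] at hw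
        exact Subtype.ext (Submodule.disjoint_def.1 (hW g) _ w.2 hw))
    refine ⟨r ∘ₗ (⨆ j ≠ g, W j).mkQ, fun w => LinearMap.congr_fun hr w, fun g' hg' w hw => ?_⟩
    rw [LinearMap.comp_apply, Submodule.mkQ_apply, (Submodule.Quotient.mk_eq_zero _).2, map_zero]
    exact Submodule.mem_iSup_of_mem g' (Submodule.mem_iSup_of_mem hg' hw)
  choose r hr hr' using hex
  have hφ : ∀ g (w : H) (hw : w ∈ W g) j,
      ((Module.Basis.ofVectorSpace K (W g)).coord j ∘ₗ r g) w =
        (Module.Basis.ofVectorSpace K (W g)).repr ⟨w, hw⟩ j := by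
    intro g w hw j
    rw [LinearMap.comp_apply, Module.Basis.coord_apply, hr g ⟨w, hw⟩]
  refine ⟨fun g j => (Module.Basis.ofVectorSpace K (W g)).coord j ∘ₗ r g, ?_, ?_, ?_⟩
  · intro g j g' hg' w hw
    rw [LinearMap.comp_apply, hr' g g' hg' w hw, map_zero]
  · intro g w hw
    simp only [hφ g w hw]
    exact ((Module.Basis.ofVectorSpace K (W g)).repr ⟨w, hw⟩).hasFiniteSupport
  · intro g w hw h
    simp only [hφ g w hw] at h
    have : (⟨w, hw⟩ : W g) = 0 := (Module.Basis.ofVectorSpace K (W g)).repr.map_eq_zero_iff.1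
      (Finsupp.ext h)
    exact congrArg Subtype.val this

lemma finiteDimensional_range_of_ker_le {K V V' H : Type*} [Field K] [AddCommGroup V] [Module K V]
    [AddCommGroup V'] [Module K V'] [FiniteDimensional K V'] [AddCommGroup H] [Module K H]
    {E : V →ₗ[K] V'} {ω : V →ₗ[K] H} (h : LinearMap.ker E ≤ LinearMap.ker ω) :
    FiniteDimensional K (LinearMap.range ω) := by
  have : FiniteDimensional K (V ⧸ LinearMap.ker E) :=
    Module.Finite.equiv E.quotKerEquivRange.symm
  rw [← Submodule.range_liftQ _ ω h]
  infer_instance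

/-! ### From an obstruction map with kernel (R/I)' to generators of I. -/

section Obstruction

variable {K G ι H : Type*} [Field K] [AddCommGroup G] [AddCommGroup H] [Module K H]
variable {I : Ideal (MvPowerSeries ι K)}

/-- An element of `S^*` is annihilated by the closed ideal with obstruction map `ω` if and only if
all its contractions are annihilated by an extension of `ω`. -/
lemma mem_dualSub_iff_forall_contract (ω : dualSub (maxIdeal K ι * I) →ₗ[K] H)
    (hω : ∀ s, ω s = 0 ↔ (s : (ι →₀ ℕ) →₀ K) ∈ dualSub I) {Ω : ((ι →₀ ℕ) →₀ K) →ₗ[K] H}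
    (hΩ : ∀ s : dualSub (maxIdeal K ι * I), Ω s = ω s) (s : (ι →₀ ℕ) →₀ K) :
    s ∈ dualSub I ↔ ∀ p, Ω (contract p s) = 0 := by
  constructor
  · intro hs p
    have hp := contract_mem_dualSub hs p
    rw [hΩ ⟨_, dualSub_le_maxIdeal_mul I hp⟩]
    exact (hω _).2 hp
  · intro hs
    -- Contraction with a nontrivial monomial lowers the polynomial degree, so by induction all
    -- proper contractions lie in `dualSub I`. Then `ω` is defined on `s`, and the hypothesis at `p
    -- = 0` says that it vanishes there.
    have key : ∀ (n : ℕ) (s : (ι →₀ ℕ) →₀ K), (∀ d ∈ s.support, d.degree < n) →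
        (∀ p, Ω (contract p s) = 0) → s ∈ dualSub I := by
      intro n
      induction n with
      | zero =>
        intro s hs _
        have : s = 0 := Finsupp.support_eq_empty.1
          (Finset.eq_empty_of_forall_notMem fun d hd => Nat.not_lt_zero _ (hs d hd))
        rw [this]
        exact zero_mem _
      | succ n ih =>
        intro s hs h
        have hB : s ∈ dualSub (maxIdeal K ι * I) := by
          rw [mem_dualSub_maxIdeal_mul]
          intro p hp
          refine ih _ (fun d hd => ?_) fun q => by rw [contract_contract]; exact h _
          rw [Finsupp.mem_support_iff, contract_apply] at hd
          have h1 := hs (d + p) (Finsupp.mem_support_iff.2 hd)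
          have h2 : p.degree ≠ 0 := fun h0 => hp ((Finsupp.degree_eq_zero_iff p).1 h0)
          rw [map_add] at h1
          omega
        refine (hω ⟨s, hB⟩).1 ?_
        rw [← hΩ ⟨s, hB⟩, ← h 0, contract_zero]
    refine key (s.support.sup (fun d => d.degree) + 1) s (fun d hd => ?_) hs
    exact Nat.lt_succ_of_le (Finset.le_sup (f := fun d : ι →₀ ℕ => d.degree) hd)

/-- An obstruction map of degree `0` extends to a linear map of degree `0` on `S^*` whose
homogeneous components have the same images. -/
lemma exists_homogeneous_extension {deg : ι → G} {Hp : G → Submodule K H}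
    (hI : IsGradedSub deg (dualSub I)) (ω : dualSub (maxIdeal K ι * I) →ₗ[K] H)
    (hdeg : ∀ g (s : dualSub (maxIdeal K ι * I)), degProj deg g (s : (ι →₀ ℕ) →₀ K) = s → ω s ∈ Hp g) :
    ∃ (W : G → Submodule K H) (F : (ι →₀ ℕ) → H), (∀ g, W g ≤ Hp g) ∧
      (∀ g, W g ≤ LinearMap.range ω) ∧ (∀ d, F d ∈ W (monDeg deg d)) ∧
      (∀ s : dualSub (maxIdeal K ι * I), Finsupp.linearCombination K F s = ω s) := by
  let B : G → Submodule K ((ι →₀ ℕ) →₀ K) := fun g =>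
    dualSub (maxIdeal K ι * I) ⊓ LinearMap.ker (degProj deg g - LinearMap.id)
  have hB : ∀ g s, s ∈ B g ↔ s ∈ dualSub (maxIdeal K ι * I) ∧ degProj deg g s = s :=
    fun g s => by
      rw [Submodule.mem_inf, LinearMap.mem_ker, LinearMap.sub_apply, sub_eq_zero]
      rfl
  let f : ∀ g, B g →ₗ[K] H := fun g => ω ∘ₗ Submodule.inclusion inf_le_left
  -- Each homogeneous part is extended with its own image as codomain, so the extension creates no
  -- values outside the range of `ω`; the finiteness of the generating set relies on this.
  have hex : ∀ g, ∃ Ω : ((ι →₀ ℕ) →₀ K) →ₗ[K] LinearMap.range (f g),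
      ∀ s : B g, (Ω s : H) = f g s := by
    intro g
    obtain ⟨Ω, hΩ⟩ := LinearMap.exists_extend (V := (ι →₀ ℕ) →₀ K) (f g).rangeRestrict
    exact ⟨Ω, fun s => congrArg Subtype.val (LinearMap.congr_fun hΩ s)⟩
  choose Ω hΩ using hex
  refine ⟨fun g => LinearMap.range (f g), fun d => Ω (monDeg deg d) (Finsupp.single d 1), ?_, ?_, ?_, ?_⟩
  · rintro g _ ⟨s, rfl⟩
    exact hdeg g _ ((hB g s).1 s.2).2
  · exact fun g => LinearMap.range_comp_le_range _ _
  · exact fun d => (Ω (monDeg deg d) (Finsupp.single d 1)).2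
  · have hhom : ∀ g s, degProj deg g s = s → Finsupp.linearCombination K
        (fun d => (Ω (monDeg deg d) (Finsupp.single d 1) : H)) s = Ω g s := by
      classical
      intro g s hs
      have h1 : s = s.sum fun d a => a • Finsupp.single d (1 : K) := by
        conv_lhs => rw [← Finsupp.sum_single s]
        simp
      conv_rhs => rw [h1, map_finsuppSum]
      rw [Finsupp.linearCombination_apply, Finsupp.sum, Finsupp.sum, AddSubmonoidClass.coe_finsetSum]
      refine Finset.sum_congr rfl fun d hd => ?_
      rw [← hs, Finsupp.mem_support_iff, degProj_apply, ne_eq, ite_eq_right_iff,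
        Classical.not_imp] at hd
      rw [hd.1, map_smul]
      rfl
    intro s
    have hmem : ∀ g, degProj deg g s ∈ dualSub (maxIdeal K ι * I) := fun g =>
      hI.maxIdeal_mul g s s.2
    have hs : s = ∑ g ∈ degrees deg (s : (ι →₀ ℕ) →₀ K), ⟨degProj deg g s, hmem g⟩ := by
      apply Subtype.ext
      rw [AddSubmonoidClass.coe_finsetSum]
      exact (sum_degProj deg _).symm
    conv_lhs => rw [← sum_degProj deg (s : (ι →₀ ℕ) →₀ K)]
    conv_rhs => rw [hs]
    rw [map_sum, map_sum]
    refine Finset.sum_congr rfl fun g _ => ?_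
    rw [hhom g _ (degProj_idem deg g s)]
    exact hΩ g ⟨_, (hB g _).2 ⟨hmem g, degProj_idem deg g (s : (ι →₀ ℕ) →₀ K)⟩⟩

/-- The obstructions to a finitely generated ideal span a finite-dimensional space. -/
lemma finiteDimensional_range_of_fg (hI : I.FG) (ω : dualSub (maxIdeal K ι * I) →ₗ[K] H)
    (hω : ∀ s, ω s = 0 ↔ (s : (ι →₀ ℕ) →₀ K) ∈ dualSub I) :
    FiniteDimensional K (LinearMap.range ω) := by
  obtain ⟨Z, hZ⟩ := hI
  let E : dualSub (maxIdeal K ι * I) →ₗ[K] (Z → K) :=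
    LinearMap.pi fun z => evalLin (z : MvPowerSeries ι K) ∘ₗ Submodule.subtype _
  -- On (R/𝔪I)' a multiple `a * f` with `f ∈ I` takes the value of `f` times the constant term of
  -- `a`. Hence vanishing on the finitely many generators is vanishing on `I`.
  have hker : LinearMap.ker E ≤ LinearMap.ker ω := by
    intro s hs
    rw [LinearMap.mem_ker, hω]
    intro f hf
    have hf' : f ∈ Submodule.span (MvPowerSeries ι K) (Z : Set (MvPowerSeries ι K)) :=
      hZ.ge hf
    induction hf' using Submodule.span_induction with
    | mem z hz => exact congrFun (LinearMap.mem_ker.1 hs) ⟨z, hz⟩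
    | zero => simp [evalAt_eq_sum]
    | add f h hf1 hh1 hf2 hh2 =>
      rw [evalAt_add, hf2 (hZ.le hf1), hh2 (hZ.le hh1), add_zero]
    | smul a f hf1 hf2 =>
      rw [smul_eq_mul, evalAt_mul]
      refine Finset.sum_eq_zero fun p _ => ?_
      by_cases hp : p = 0
      · rw [hp, contract_zero, hf2 (hZ.le hf1), mul_zero]
      · rw [mem_dualSub_maxIdeal_mul.1 s.2 p hp f (hZ.le hf1), mul_zero]
  exact finiteDimensional_range_of_ker_le (V := dualSub (maxIdeal K ι * I)) hker

/-- The generators of a closed ideal coming from an injective obstruction map of degree `0`. -/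
theorem exists_generators_of_obstruction {K : Type uK} {G : Type uG} {ι : Type uι}
    {H : Type uL} [Field K] [AddCommGroup G] {I : Ideal (MvPowerSeries ι K)} {deg : ι → G} [AddCommGroup H] [Module K H]
    {Hp : G → Submodule K H} (hHp : iSupIndep Hp) (hcl : IsClosedIdeal I)
    (hI : IsGradedSub deg (dualSub I)) (ω : dualSub (maxIdeal K ι * I) →ₗ[K] H)
    (hω : ∀ s, ω s = 0 ↔ (s : (ι →₀ ℕ) →₀ K) ∈ dualSub I)
    (hdeg : ∀ g (s : dualSub (maxIdeal K ι * I)), degProj deg g (s : (ι →₀ ℕ) →₀ K) = s → ω s ∈ Hp g) :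
    (∃ T : G → Set (MvPowerSeries ι K),
      (∀ g, ∀ t ∈ T g, IsHomogeneousOfDegree deg t g) ∧
      (∀ g, Cardinal.lift.{uL} (Cardinal.mk (T g)) ≤
        Cardinal.lift.{max uK uι} (Module.rank K (Hp g))) ∧
      FormallyGenerates (⋃ g, T g) I ∧ (I.FG → I = Ideal.span (⋃ g, T g))) ∧
    (∃ F : (ι →₀ ℕ) → H, (∀ d, F d ∈ Hp (monDeg deg d)) ∧
      TopologicallyGenerates (components F) I ∧ (I.FG → I = Ideal.span (components F))) := by
  obtain ⟨W, F, hWH, hWω, hF, hFω⟩ := exists_homogeneous_extension hI ω hdeg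
  have hW : iSupIndep W := hHp.mono hWH
  obtain ⟨φ, hφ, hφfin, hφ0⟩ := exists_coordinates hW
  have hmem := mem_dualSub_iff_forall_contract ω hω hFω
  let t : ∀ g, Module.Basis.ofVectorSpaceIndex K (W g) → MvPowerSeries ι K :=
    fun g j => ofCoeff fun d => φ g j (F d)
  have heval : ∀ (f : MvPowerSeries ι K) (ψ : Module.Dual K H),
      (∀ d, MvPowerSeries.coeff d f = ψ (F d)) → ∀ s,
      evalAt f s = ψ (Finsupp.linearCombination K F s) := by
    intro f ψ hf s
    rw [evalAt_eq_sum, Finsupp.linearCombination_apply, map_finsuppSum]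
    refine Finset.sum_congr rfl fun d _ => ?_
    change s d * _ = ψ (s d • F d)
    rw [hf, map_smul, smul_eq_mul]
  have ht : ∀ g j s, evalAt (t g j) s = φ g j (Finsupp.linearCombination K F s) :=
    fun g j => heval _ _ fun _ => rfl
  have hzero : ∀ s, (∀ g j, φ g j (Finsupp.linearCombination K F s) = 0) →
      Finsupp.linearCombination K F s = 0 := by
    intro s h
    have hcomp : ∀ g s', degProj deg g s' = s' → Finsupp.linearCombination K F s' ∈ W g := by
      classical
      intro g s' hs'
      rw [Finsupp.linearCombination_apply, Finsupp.sum]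
      refine sum_mem fun d hd => (W g).smul_mem _ ?_
      rw [← hs', Finsupp.mem_support_iff, degProj_apply, ne_eq, ite_eq_right_iff,
        Classical.not_imp] at hd
      exact hd.1 ▸ hF d
    have hsum := congrArg (Finsupp.linearCombination K F) (sum_degProj deg s)
    rw [map_sum] at hsum
    rw [← hsum]
    refine Finset.sum_eq_zero fun g hg => ?_
    -- The coordinates for `g` kill the other pieces, so on the full sum they see only the component
    -- of degree `g`.
    refine hφ0 g _ (hcomp g _ (degProj_idem deg g s)) fun j => ?_
    rw [← h g j, ← hsum, map_sum, Finset.sum_eq_single g]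
    · intro g' _ hg'
      exact hφ g j g' hg' _ (hcomp g' _ (degProj_idem deg g' s))
    · exact fun hne => absurd hg hne
  have hhom : ∀ g j d, MvPowerSeries.coeff d (t g j) ≠ 0 → monDeg deg d = g := by
    intro g j d hd
    by_contra hne
    exact hd (hφ g j _ hne _ (hF d))
  have hlf : ∀ d, {f ∈ ⋃ g, Set.range (t g) | MvPowerSeries.coeff d f ≠ 0}.Finite := by
    intro d
    -- The monomial `x^d` occurs only in generators of its own degree, and `F d` has finitely many
    -- nonzero coordinates.
    refine ((hφfin _ _ (hF d)).image (t (monDeg deg d))).subset ?_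
    rintro f ⟨hf, hd⟩
    obtain ⟨g, j, rfl⟩ := Set.mem_iUnion.1 hf
    obtain rfl := hhom g j d hd
    exact ⟨j, hd, rfl⟩
  have hgen : FormallyGenerates (⋃ g, Set.range (t g)) I := by
    refine formallyGenerates_of_mem_dualSub_iff hcl hlf fun s => ?_
    rw [hmem]
    constructor
    · intro h f hf p
      obtain ⟨g, j, rfl⟩ := Set.mem_iUnion.1 hf
      rw [ht, h p, map_zero]
    · intro h p
      exact hzero _ fun g j => by
        rw [← ht]
        exact h _ (Set.mem_iUnion.2 ⟨g, j, rfl⟩) p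
  have hspan : I.FG → I = Ideal.span (⋃ g, Set.range (t g)) := by
    intro hfg
    refine hgen.eq_span ?_
    have := finiteDimensional_range_of_fg hfg ω hω
    have : ∀ g, FiniteDimensional K (W g) := fun g =>
      Submodule.finiteDimensional_of_le (hWω g)
    -- Nonzero vectors from different `W g` are linearly independent in the finite-dimensional range
    -- of `ω`.
    have hfinW : {g | W g ≠ ⊥}.Finite := by
      have hex : ∀ g : {g | W g ≠ ⊥}, ∃ w ∈ W g, w ≠ 0 := fun g =>
        Submodule.exists_mem_ne_zero_of_ne_bot g.2
      choose w hw hw0 using hex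
      have hlin : LinearIndependent K fun g => (⟨w g, hWω g (hw g)⟩ : LinearMap.range ω) :=
        LinearIndependent.of_comp (LinearMap.range ω).subtype
          (iSupIndep.linearIndependent _ (hW.comp Subtype.val_injective) hw hw0)
      have := hlin.finite
      exact Set.toFinite _
    have hne : ∀ g, W g = ⊥ → Set.range (t g) = ∅ := by
      intro g hg
      rw [Set.range_eq_empty_iff]
      refine ⟨fun j => (Module.Basis.ofVectorSpace K (W g)).ne_zero j (Subtype.ext ?_)⟩
      exact (Submodule.eq_bot_iff _).1 hg _ (Subtype.mem _)
    have hsub : ⋃ g, Set.range (t g) ⊆ ⋃ g ∈ {g | W g ≠ ⊥}, Set.range (t g) := by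
      intro f hf
      obtain ⟨g, hg⟩ := Set.mem_iUnion.1 hf
      refine Set.mem_biUnion (x := g) (fun h => ?_) hg
      rw [hne g h] at hg
      exact hg
    exact (hfinW.biUnion fun g _ => Set.finite_range (t g)).subset hsub
  have hTC : ⋃ g, Set.range (t g) ⊆ components F := by
    intro f hf
    obtain ⟨g, j, rfl⟩ := Set.mem_iUnion.1 hf
    exact ⟨φ g j, fun _ => rfl⟩
  have hCI : (components F : Set (MvPowerSeries ι K)) ⊆ I := by
    rintro f ⟨ψ, hψ⟩
    refine hcl f fun s hs => ?_
    have := (hmem s).1 hs 0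
    rw [contract_zero] at this
    rw [heval f ψ hψ, this, map_zero]
  refine ⟨⟨fun g => Set.range (t g), ?_, ?_, hgen, hspan⟩,
    F, fun d => hWH _ (hF d), hgen.topologicallyGenerates hcl hTC hCI, fun hfg => ?_⟩
  · rintro g _ ⟨j, rfl⟩ d hd
    exact hhom g j d hd
  · intro g
    refine Cardinal.mk_range_le_lift.trans ?_
    rw [Cardinal.lift_le, (Module.Basis.ofVectorSpace K (W g)).mk_eq_rank'']
    exact Submodule.rank_mono (hWH g)
  · refine le_antisymm ?_ (Ideal.span_le.2 hCI)
    rw [hspan hfg]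
    exact Ideal.span_mono hTC

end Obstruction

/-! ### The obstruction map of the limit base. -/

namespace IsMiniversalConstruction

variable {K L G ι : Type*} [Field K] [LieRing L] [LieAlgebra K L] [AddCommGroup G]
variable {𝒜 : G → Submodule K L} {b : Module.Basis ι K (H2 𝒜)} {deg : ι → G}
variable {α : (ι →₀ ℕ) → Cochain K L 2} {I : ℕ → Ideal (MvPowerSeries ι K)}

lemma jacValue_eq_zero (hI : IsMiniversalConstruction 𝒜 b deg α I) {k : ℕ}
    {s : (ι →₀ ℕ) →₀ K} (hs : s ∈ dualSub (I k)) : jacValue α s = 0 :=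
  (jacobiatorAt_eq_zero_iff α s).1 (hI.jacobi k s hs)

lemma mem_succ_iff (hI : IsMiniversalConstruction 𝒜 b deg α I) (k : ℕ)
    (f : MvPowerSeries ι K) : f ∈ I (k + 1) ↔
      ∀ s ∈ dualSub (maxIdeal K ι * I k) ⊓ (coboundary 𝒜 1).comap (jacValue α),
        evalAt f s = 0 := by
  rw [hI.next]
  simp only [Submodule.mem_inf, Submodule.mem_comap, jacValue_mem_coboundary_iff, and_imp]
  rfl

/-- The space `(R / I_{k+1})'` is the kernel of the obstruction map on `(R / (𝔪 I_k))'`. -/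
lemma dualSub_succ (hI : IsMiniversalConstruction 𝒜 b deg α I) (k : ℕ) :
    dualSub (I (k + 1)) =
      dualSub (maxIdeal K ι * I k) ⊓ (coboundary 𝒜 1).comap (jacValue α) :=
  dualSub_eq_of_mem_iff (hI.mem_succ_iff k)

lemma isClosedIdeal (hI : IsMiniversalConstruction 𝒜 b deg α I) (k : ℕ) :
    IsClosedIdeal (I k) := by
  cases k with
  | zero =>
    intro f hf
    rw [hI.first]
    intro d hd
    have := hf (Finsupp.single d 1) fun h hh => by
      rw [evalAt_single, (hI.first h).1 hh d hd, mul_zero]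
    rwa [evalAt_single, one_mul] at this
  | succ k => exact isClosedIdeal_of_mem_iff (hI.mem_succ_iff k)

/-- On (R/I_k)' the jacobiator is zero, in particular a coboundary, so nothing is lost at the next
stage. -/
lemma dualSub_monotone (hI : IsMiniversalConstruction 𝒜 b deg α I) :
    Monotone fun k => dualSub (I k) := by
  refine monotone_nat_of_le_succ fun k s hs => ?_
  rw [hI.dualSub_succ, Submodule.mem_inf, Submodule.mem_comap, hI.jacValue_eq_zero hs]
  exact ⟨dualSub_le_maxIdeal_mul _ hs, zero_mem _⟩

lemma isClosedIdeal_iInf (hI : IsMiniversalConstruction 𝒜 b deg α I) :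
    IsClosedIdeal (⨅ k, I k) := fun _ hf =>
  Ideal.mem_iInf.2 fun k => hI.isClosedIdeal k _ fun s hs => hf s (dualSub_anti (iInf_le I k) hs)

/-- The base of the miniversal deformation is dual to the union of the dual spaces of the bases
of its finite stages. -/
lemma mem_dualSub_iInf (hI : IsMiniversalConstruction 𝒜 b deg α I) {s : (ι →₀ ℕ) →₀ K} :
    s ∈ dualSub (⨅ k, I k) ↔ ∃ k, s ∈ dualSub (I k) := by
  have h : dualSub (⨅ k, I k) = ⨆ k, dualSub (I k) := dualSub_eq_of_mem_iff fun f => by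
    constructor
    · intro hf s hs
      obtain ⟨k, hk⟩ := (Submodule.mem_iSup_of_directed _ hI.dualSub_monotone.directed_le).1 hs
      exact hk f (Ideal.mem_iInf.1 hf k)
    · exact fun hf => Ideal.mem_iInf.2 fun k => hI.isClosedIdeal k f fun s hs =>
        hf s (Submodule.mem_iSup_of_mem k hs)
  rw [h, Submodule.mem_iSup_of_directed _ hI.dualSub_monotone.directed_le]

/-- Only finitely many contractions of `s` are nonzero and the stages increase, so one `k` serves
all of them. -/
lemma exists_mem_dualSub_maxIdeal_mul (hI : IsMiniversalConstruction 𝒜 b deg α I)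
    {s : (ι →₀ ℕ) →₀ K} (hs : s ∈ dualSub (maxIdeal K ι * ⨅ k, I k)) :
    ∃ k, s ∈ dualSub (maxIdeal K ι * I k) := by
  rw [mem_dualSub_maxIdeal_mul] at hs
  have hex : ∀ p : ι →₀ ℕ, ∃ k, p ≠ 0 → contract p s ∈ dualSub (I k) := by
    intro p
    by_cases hp : p = 0
    · exact ⟨0, fun h => absurd hp h⟩
    · obtain ⟨k, hk⟩ := hI.mem_dualSub_iInf.1 (hs p hp)
      exact ⟨k, fun _ => hk⟩
  choose k hk using hex
  refine ⟨(divisors s).sup k, mem_dualSub_maxIdeal_mul.2 fun p hp => ?_⟩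
  by_cases hd : p ∈ divisors s
  · exact hI.dualSub_monotone (Finset.le_sup hd) (hk p hp)
  · rw [contract_eq_zero hd]
    exact zero_mem _

lemma jacValue_contract_eq_zero (hI : IsMiniversalConstruction 𝒜 b deg α I)
    {s : (ι →₀ ℕ) →₀ K} (hs : s ∈ dualSub (maxIdeal K ι * ⨅ k, I k)) :
    ∀ p ≠ 0, jacValue α (contract p s) = 0 := fun p hp => by
  obtain ⟨k, hk⟩ := hI.mem_dualSub_iInf.1 (mem_dualSub_maxIdeal_mul.1 hs p hp)
  exact hI.jacValue_eq_zero hk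

lemma jacValue_mem_cocycle (hI : IsMiniversalConstruction 𝒜 b deg α I)
    (s : dualSub (maxIdeal K ι * ⨅ k, I k)) : jacValue α s ∈ cocycle 𝒜 2 :=
  ⟨jacValue_mem_gradedCochain hI.degree_zero s,
    delta_jacValue_eq_zero α hI.reduction (hI.jacValue_contract_eq_zero s.2)⟩

/-- The obstruction map from `(R / (𝔪 I))'` to `H^3(L;L)`, where `R / I` is the base of the
miniversal deformation. -/
def obstruction (hI : IsMiniversalConstruction 𝒜 b deg α I) :
    dualSub (maxIdeal K ι * ⨅ k, I k) →ₗ[K] H3 𝒜 :=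
  ((coboundary 𝒜 1).submoduleOf (cocycle 𝒜 2)).mkQ ∘ₗ
    (jacValue α ∘ₗ Submodule.subtype _).codRestrict (cocycle 𝒜 2) hI.jacValue_mem_cocycle

/-- A vanishing class at a stage `k` with `s` in (R/𝔪I_k)' is the condition for surviving to stage
`k + 1`; conversely the jacobiator itself vanishes on every stage. -/
lemma obstruction_eq_zero_iff (hI : IsMiniversalConstruction 𝒜 b deg α I)
    (s : dualSub (maxIdeal K ι * ⨅ k, I k)) :
    hI.obstruction s = 0 ↔ (s : (ι →₀ ℕ) →₀ K) ∈ dualSub (⨅ k, I k) := by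
  have h : hI.obstruction s = 0 ↔ jacValue α s ∈ coboundary 𝒜 1 :=
    Submodule.Quotient.mk_eq_zero _
  rw [h, hI.mem_dualSub_iInf]
  constructor
  · intro hs
    obtain ⟨k, hk⟩ := hI.exists_mem_dualSub_maxIdeal_mul s.2
    refine ⟨k + 1, ?_⟩
    rw [hI.dualSub_succ]
    exact ⟨hk, hs⟩
  · rintro ⟨k, hk⟩
    rw [hI.jacValue_eq_zero hk]
    exact zero_mem _

lemma obstruction_mem_H3piece (hI : IsMiniversalConstruction 𝒜 b deg α I) (g : G)
    (s : dualSub (maxIdeal K ι * ⨅ k, I k))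
    (hs : degProj deg g (s : (ι →₀ ℕ) →₀ K) = s) : hI.obstruction s ∈ H3piece 𝒜 g := by
  refine ⟨⟨jacValue α s, hI.jacValue_mem_cocycle s⟩, ?_, rfl⟩
  change jacValue α s ∈ homCochain 𝒜 3 g
  rw [← hs]
  exact jacValue_degProj_mem hI.degree_zero g s

lemma isGradedSub [DecidableEq G] (hI : IsMiniversalConstruction 𝒜 b deg α I)
    (h𝒜 : DirectSum.IsInternal 𝒜)
    (hbracket : ∀ (g h : G) (x y : L), x ∈ 𝒜 g → y ∈ 𝒜 h → ⁅x, y⁆ ∈ 𝒜 (g + h)) (k : ℕ) :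
    IsGradedSub deg (dualSub (I k)) := by
  induction k with
  | zero =>
    intro g s hs f hf
    -- The degree-`g` part of `f` remains in `I 0`, which is cut out by single coefficients, and its
    -- value on `s` is that of `f` on the projection of `s`.
    let f' : MvPowerSeries ι K :=
      ofCoeff fun d => if monDeg deg d = g then MvPowerSeries.coeff d f else 0
    have hf' : f' ∈ I 0 := (hI.first f').2 fun d hd => by
      rw [coeff_ofCoeff, (hI.first f).1 hf d hd, ite_self]
    rw [← hs f' hf', ← evalLin_apply, ← evalLin_apply]
    have : evalLin f ∘ₗ degProj deg g = evalLin f' := by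
      ext d
      simp only [LinearMap.comp_apply, Finsupp.lsingle_apply]
      rw [evalLin_apply, evalLin_apply, evalAt_single, coeff_ofCoeff, one_mul]
      by_cases hd : monDeg deg d = g
      · rw [degProj_single_of_eq deg hd, evalAt_single, one_mul, if_pos hd]
      · rw [degProj_single_of_ne deg hd, if_neg hd, ← evalLin_apply, map_zero]
    exact LinearMap.congr_fun this s
  | succ k ih =>
    intro g s hs
    rw [hI.dualSub_succ] at hs ⊢
    exact ⟨ih.maxIdeal_mul g s hs.1,
      jacValue_degProj_mem_coboundary h𝒜 hbracket hI.degree_zero hs.2 g⟩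

lemma isGradedSub_iInf [DecidableEq G] (hI : IsMiniversalConstruction 𝒜 b deg α I)
    (h𝒜 : DirectSum.IsInternal 𝒜)
    (hbracket : ∀ (g h : G) (x y : L), x ∈ 𝒜 g → y ∈ 𝒜 h → ⁅x, y⁆ ∈ 𝒜 (g + h)) :
    IsGradedSub deg (dualSub (⨅ k, I k)) := by
  intro g s hs
  obtain ⟨k, hk⟩ := hI.mem_dualSub_iInf.1 hs
  exact hI.mem_dualSub_iInf.2 ⟨k, hI.isGradedSub h𝒜 hbracket k g s hk⟩

end IsMiniversalConstruction

end GradedLie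

end

open GradedLie
theorem proposition7p3 {K : Type uK} {L : Type uL} {G : Type uG} {ι : Type uι}
    [Field K] [CharZero K] [LieRing L] [LieAlgebra K L]
    [AddCommGroup G] [DecidableEq G]
    -- a `G`-graded Lie algebra
    (𝒜 : G → Submodule K L) (h𝒜 : DirectSum.IsInternal 𝒜)
    (hbracket : ∀ (g h : G) (x y : L), x ∈ 𝒜 g → y ∈ 𝒜 h → ⁅x, y⁆ ∈ 𝒜 (g + h))
    (hfin : ∀ g, FiniteDimensional K (H2piece 𝒜 g))
    -- a homogeneous basis of `H^2(L;L)`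
    (b : Module.Basis ι K (H2 𝒜)) (deg : ι → G) (hb : ∀ i, b i ∈ H2piece 𝒜 (deg i))
    -- the construction of the base of the miniversal deformation
    (α : (ι →₀ ℕ) → Cochain K L 2) (I : ℕ → Ideal (MvPowerSeries ι K))
    (hI : IsMiniversalConstruction 𝒜 b deg α I) :
    -- `⨅ k, I k` has homogeneous generators, at most `dim H^3_{(g)}(L;L)` of them of degree `g`
    (∃ T : G → Set (MvPowerSeries ι K),
      (∀ g, ∀ t ∈ T g, IsHomogeneousOfDegree deg t g) ∧
      (∀ g, Cardinal.lift.{uL} (Cardinal.mk (T g)) ≤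
        Cardinal.lift.{max uK uι} (Module.rank K (H3piece 𝒜 g))) ∧
      FormallyGenerates (⋃ g, T g) (⨅ k, I k) ∧
      (FiniteDimensional K (H2 𝒜) → ⨅ k, I k = Ideal.span (⋃ g, T g))) ∧
    -- the base is the zero locus of a formal map `H^2(L;L) → H^3(L;L)` of degree `0`
    (∃ F : (ι →₀ ℕ) → H3 𝒜,
      (∀ d, F d ∈ H3piece 𝒜 (monDeg deg d)) ∧
      TopologicallyGenerates (components F) (⨅ k, I k) ∧
      (FiniteDimensional K (H2 𝒜) → ⨅ k, I k = Ideal.span (components F))) := by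
  -- Finitely many variables make the power series ring noetherian.
  have hfg : FiniteDimensional K (H2 𝒜) → (⨅ k, I k).FG := fun h => by
    have : Finite ι := Module.Finite.finite_basis b
    exact IsNoetherian.noetherian _
  obtain ⟨⟨T, h1, h2, h3, h4⟩, F, h5, h6, h7⟩ := exists_generators_of_obstruction
    (iSupIndep_H3piece h𝒜 hbracket) hI.isClosedIdeal_iInf (hI.isGradedSub_iInf h𝒜 hbracket)
    hI.obstruction hI.obstruction_eq_zero_iff hI.obstruction_mem_H3piece
  exact ⟨⟨T, h1, h2, h3, fun h => h4 (hfg h)⟩, F, h5, h6, fun h => h7 (hfg h)⟩
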